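/- Fix $n\ge 1$ and a norm $\|\cdot\|$ on $\mathbb R^n$; matrices $M_n(\mathbb R)$ carry the induced operator norm. Let $\mathscr M\subset M_n(\mathbb R)$ be bounded. For a signal $A\in L_\infty$, let $\Phi_A(t,0)$ be the flow from time $0$ to time $t$ of $\dot x=A(t)x$, i.e. $\Phi_A(t,0)=\mathrm{Id}+\int_0^tA(\tau)\Phi_A(\tau,0)\,d\tau$. For signals $A$ on $[0,s]$ and $B$ on $[0,t]$, the concatenation $A\ast B$ on $[0,s+t]$ equals $A$ on $[0,s]$ and $B(\cdot-s)$ on $(s,s+t]$. Let $\mathcal S\subset L_\infty([0,\infty),\mathscr M)$ be nonempty, let $\mathcal F_t\subset L_\infty([0,t],\mathscr M)$ for each $t\ge0$ (possibly empty), and put $$\mathcal F_\infty=\Big\{A_1\ast A_2\ast\cdots\ :\ A_k\in\mathcal F_{t_k},\ \sum_k t_k=\infty\Big\},\qquad \Phi(\mathcal F_t)=\{\Phi_A(t,0):A\in\mathcal F_t\},\qquad \Phi(\mathcal F)=\bigcup_{t\ge0}\Phi(\mathcal F_t),$$ $$\mu(\mathcal F)=\limsup_{t\to+\infty}\ \sup\{\|R\|^{1/t}:R\in\Phi(\mathcal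 F_t)\}\quad(\sup\emptyset=0),$$ $$\mathscr R_\infty=\{R:\ \exists\,t_k\to\infty,\ R_k\in\Phi(\mathcal F_{t_k})\text{ with }\mu(\mathcal F)^{-t_k}R_k\to R\}.$$ A set of matrices is called irreducible if its only common invariant subspaces are $\{0\}$ and $\mathbb R^n$. Assume: * **A0.** If $A\in\mathcal S$ and $t\ge0$, then $A(t+\cdot)\in\mathcal S$. * **A1.** $\mathcal F_s\ast\mathcal F_t\subset\mathcal F_{s+t}$ for all $s,t\ge0$. * **A2.** $\Phi(\mathcal F)$ is irreducible. * **A3.** $\mathcal F_\infty\subset\mathcal S$, and there are $C,\Delta\ge0$ and a compact $\mathscr K\subset \mathrm{GL}(n)$ such that for all $t\ge0$ and $A\in\mathcal S$ there exist $K\in\mathscr K$, $\hat t\in[t,t+\Delta]$ and $R\in\Phi(\mathcal F_{\hat t})$ with $\|\Phi_A(t,0)KR^{-1}\|\le C$; moreover, if $A\in\mathcal F_\infty$, one can take $K=\mathrm{Id}$. Then: 1. $\mathscr R_\infty$ is compact and nonempty, and $\mathscr R_\infty\ne\{0\}$; it is closed under multiplication; for all $t\ge0$, $T\in\Phi(\mathcal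 F_t)$ and $Q\in\mathscr R_\infty$, both $\mu(\mathcal F)^{-t}TQ$ and $\mu(\mathcal F)^{-t}QT$ belong to $\mathscr R_\infty$; and $\mathscr R_\infty$ is irreducible. 2. $\hat v(x)=\max_{R\in\mathscr R_\infty}\|Rx\|$ is well defined (the maximum is attained) and is an extremal norm for $\Phi(\mathcal F)$: it is a norm on $\mathbb R^n$ whose induced matrix norm satisfies $\|R\|_{\hat v}\le\mu(\mathcal F)^t$ for all $t\ge0$ and $R\in\Phi(\mathcal F_t)$. 3. $\Phi(\mathcal F)$ is quasi-extremal (there is $C_{\rm qe}>0$ with $\|R\|\le C_{\rm qe}\,\mu(\mathcal F)^t$ for all $t\ge0$ and $R\in\Phi(\mathcal F_t)$), extremal (quasi-extremal, and an extremal norm exists) and quasi-Barabanov: there is $C_{\rm qb}>0$ such that for every $x\in\mathbb R^n$ and $t\ge0$ there exist $t'\ge t$ and $R\in\Phi(\mathcal F_{t'})$ with $\|Rx\|\ge C_{\rm qb}\,\mu(\mathcal F)^{t'}\|x\|$. 4. There is $C_{\rm qx}\ge1$ such that for every $x_0\ne0$ there is $A$ in the weak-$\star$ closure of $\mathcal F_\infty$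 in $L_\infty([0,\infty),M_n(\mathbb R))$ with $$\frac1{C_{\rm qx}}\,\mu(\mathcal F)^t\|x_0\|\le\|\Phi_A(t,0)x_0\|\le C_{\rm qx}\,\mu(\mathcal F)^t\|x_0\|\qquad\text{for all }t\ge0.$$ -/

import Mathlib

open MeasureTheory Filter Topology
open scoped NNReal ENNReal

noncomputable section

namespace SwitchedSystem

variable {E : Type*} [NormedAddCommGroup E] [NormedSpace ℝ E]

/-- Matrices: linear endomorphisms of the state space `E` (which is `ℝⁿ` with some norm), with the
induced operator norm and with composition as product. -/
abbrev Mat (E : Type*) [NormedAddCommGroup E] [NormedSpace ℝ E] : Type _ := E →L[ℝ] E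

/-- Signals on the finite interval `[0,t]`: elements of `L_∞([0,t], Mat E)`. -/
abbrev FinSignal (E : Type*) [NormedAddCommGroup E] [NormedSpace ℝ E] (t : ℝ≥0) : Type _ :=
  Lp (Mat E) ∞ (volume.restrict (Set.Icc (0 : ℝ) (t : ℝ)))

/-- Signals on `[0,∞)`: elements of `L_∞([0,∞), Mat E)`. -/
abbrev InfSignal (E : Type*) [NormedAddCommGroup E] [NormedSpace ℝ E] : Type _ :=
  Lp (Mat E) ∞ (volume.restrict (Set.Ici (0 : ℝ)))

/-- `Ψ` is, on `[0,t]`, the absolutely continuous matrix solution of `Ψ' = A Ψ`, `Ψ(0) = Id`. -/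
def IsFundamentalSolution (A : ℝ → Mat E) (t : ℝ) (Ψ : ℝ → Mat E) : Prop :=
  ContinuousOn Ψ (Set.Icc 0 t) ∧
    ∀ τ ∈ Set.Icc 0 t, Ψ τ = 1 + ∫ r in (0 : ℝ)..τ, A r * Ψ r

open Classical in
/-- The flow `Φ_A(t,0)` of `x' = A x`, for `t ≥ 0`: the value at time `t` of the fundamental
solution (which exists and is unique on `[0,t]` when `A` is essentially bounded there). -/
def flow (A : ℝ → Mat E) (t : ℝ) : Mat E :=
  if h : ∃ Ψ, IsFundamentalSolution A t Ψ then h.choose t else 0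

/-- The concatenation `A ∗ B`: `A` on `[0,s]`, followed by `B(· - s)`. -/
def concat (s : ℝ) (A B : ℝ → Mat E) : ℝ → Mat E :=
  fun τ => if τ ≤ s then A τ else B (τ - s)

/-- The infinite concatenations `A₀ ∗ A₁ ∗ ⋯` with `A_k ∈ F_{t_k}` and `∑ t_k = ∞`. -/
def Finfty (F : (t : ℝ≥0) → Set (FinSignal E t)) : Set (InfSignal E) :=
  {A | ∃ (t : ℕ → ℝ≥0) (a : (k : ℕ) → FinSignal E (t k)),
    (∀ k, a k ∈ F (t k)) ∧
    Tendsto (fun k => ∑ i ∈ Finset.range k, t i) atTop atTop ∧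
    ∀ k, (fun τ : ℝ => A ((∑ i ∈ Finset.range k, (t i : ℝ)) + τ))
      =ᵐ[volume.restrict (Set.Icc (0 : ℝ) (t k : ℝ))] a k}

/-- `Φ(F_t)`. -/
def PhiAt (F : (t : ℝ≥0) → Set (FinSignal E t)) (t : ℝ≥0) : Set (Mat E) :=
  (fun A : FinSignal E t => flow A t) '' F t

/-- `Φ(F) = ⋃_{t ≥ 0} Φ(F_t)`. -/
def Phi (F : (t : ℝ≥0) → Set (FinSignal E t)) : Set (Mat E) :=
  ⋃ t : ℝ≥0, PhiAt F t

/-- `μ(F) = limsup_{t → ∞} sup {‖R‖^{1/t} : R ∈ Φ(F_t)}`, with the supremum over the empty set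
equal to `0`. -/
def mu (F : (t : ℝ≥0) → Set (FinSignal E t)) : ℝ :=
  limsup (fun t : ℝ≥0 => sSup ((fun R : Mat E => ‖R‖ ^ (1 / (t : ℝ))) '' PhiAt F t)) atTop

/-- A set of matrices is irreducible if its only common invariant subspaces are `{0}` and `E`. -/
def IsIrreducible (𝓡 : Set (Mat E)) : Prop :=
  ∀ V : Submodule ℝ E, (∀ R ∈ 𝓡, ∀ x ∈ V, R x ∈ V) → V = ⊥ ∨ V = ⊤

/-- Shift-invariance: if `A ∈ S` and `t ≥ 0` then `A(t + ·) ∈ S`. -/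
def ShiftInvariant (S : Set (InfSignal E)) : Prop :=
  ∀ A ∈ S, ∀ t : ℝ≥0, ∃ B ∈ S,
    B =ᵐ[volume.restrict (Set.Ici (0 : ℝ))] fun τ : ℝ => A ((t : ℝ) + τ)

/-- Concatenability: `F_s ∗ F_t ⊆ F_{s+t}`. -/
def Concatenable (F : (t : ℝ≥0) → Set (FinSignal E t)) : Prop :=
  ∀ s t : ℝ≥0, ∀ A ∈ F s, ∀ B ∈ F t, ∃ D ∈ F (s + t),
    D =ᵐ[volume.restrict (Set.Icc (0 : ℝ) ((s + t : ℝ≥0) : ℝ))] concat (s : ℝ) A B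

/-- Fatness. The units of `Mat E` form the group `GL(E)`; a flow `R` is always invertible, so
`Ring.inverse R` is its genuine inverse. -/
def Fat (S : Set (InfSignal E)) (F : (t : ℝ≥0) → Set (FinSignal E t)) : Prop :=
  Finfty F ⊆ S ∧
  ∃ (C : ℝ) (Δ : ℝ≥0) (𝓚 : Set (Mat E)ˣ), 0 ≤ C ∧ IsCompact 𝓚 ∧
    (∀ t : ℝ≥0, ∀ A ∈ S, ∃ K ∈ 𝓚, ∃ t' ∈ Set.Icc t (t + Δ), ∃ R ∈ PhiAt F t',
      ‖flow A t * (K : Mat E) * Ring.inverse R‖ ≤ C) ∧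
    (∀ t : ℝ≥0, ∀ A ∈ Finfty F, ∃ t' ∈ Set.Icc t (t + Δ), ∃ R ∈ PhiAt F t',
      ‖flow A t * Ring.inverse R‖ ≤ C)

/-- The limit set `R_∞` of all limits of `μ(F)^{-t_k} R_k` with `R_k ∈ Φ(F_{t_k})`, `t_k → ∞`. -/
def Rinfty (F : (t : ℝ≥0) → Set (FinSignal E t)) : Set (Mat E) :=
  {R | ∃ (t : ℕ → ℝ≥0) (r : ℕ → Mat E), Tendsto t atTop atTop ∧ (∀ k, r k ∈ PhiAt F (t k)) ∧
    Tendsto (fun k => mu F ^ (-(t k : ℝ)) • r k) atTop (𝓝 R)}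

/-- `v̂(x) = max {‖R x‖ : R ∈ R_∞}`, written as a supremum. -/
def vhat (F : (t : ℝ≥0) → Set (FinSignal E t)) (x : E) : ℝ :=
  sSup ((fun R : Mat E => ‖R x‖) '' Rinfty F)

/-- `w` is a norm on the real vector space `E`. -/
structure IsNorm (w : E → ℝ) : Prop where
  nonneg : ∀ x, 0 ≤ w x
  eq_zero : ∀ x, w x = 0 → x = 0
  add_le : ∀ x y, w (x + y) ≤ w x + w y
  smul : ∀ (c : ℝ) (x : E), w (c • x) = |c| * w x

/-- The matrix norm induced by a norm `w`. -/
def inducedNorm (w : E → ℝ) (R : Mat E) : ℝ :=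
  sSup ((fun x => w (R x)) '' {x | w x ≤ 1})

/-- `w` is an extremal norm for `Φ(F)`. -/
def IsExtremalNorm (F : (t : ℝ≥0) → Set (FinSignal E t)) (w : E → ℝ) : Prop :=
  IsNorm w ∧ ∀ t : ℝ≥0, ∀ R ∈ PhiAt F t, inducedNorm w R ≤ mu F ^ (t : ℝ)

def QuasiExtremal (F : (t : ℝ≥0) → Set (FinSignal E t)) : Prop :=
  ∃ C : ℝ, 0 < C ∧ ∀ t : ℝ≥0, ∀ R ∈ PhiAt F t, ‖R‖ ≤ C * mu F ^ (t : ℝ)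

def Extremal (F : (t : ℝ≥0) → Set (FinSignal E t)) : Prop :=
  QuasiExtremal F ∧ ∃ w : E → ℝ, IsExtremalNorm F w

def QuasiBarabanov (F : (t : ℝ≥0) → Set (FinSignal E t)) : Prop :=
  QuasiExtremal F ∧ ∃ C : ℝ, 0 < C ∧ ∀ (x : E) (t : ℝ≥0), ∃ t' : ℝ≥0, t ≤ t' ∧
    ∃ R ∈ PhiAt F t', C * mu F ^ (t' : ℝ) * ‖x‖ ≤ ‖R x‖

/-- The weak-star topology of `L_∞([0,∞), Mat E)` as the dual of `L_1([0,∞), (Mat E)^*)`. -/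
@[reducible] def weakStarTopology (E : Type*) [NormedAddCommGroup E] [NormedSpace ℝ E] :
    TopologicalSpace (InfSignal E) :=
  TopologicalSpace.induced
    (fun (A : InfSignal E)
      (φ : Lp (StrongDual ℝ (Mat E)) 1 (volume.restrict (Set.Ici (0 : ℝ)))) =>
        ∫ τ in Set.Ici (0 : ℝ), (φ τ) (A τ))
    inferInstance

def weakStarClosure (X : Set (InfSignal E)) : Set (InfSignal E) :=
  @closure _ (weakStarTopology E) X

/-- The trajectory `t ↦ Φ_A(t,0) x₀` is quasi-extremal with constant `C`. -/
def IsQuasiExtremalTrajectory (F : (t : ℝ≥0) → Set (FinSignal E t)) (C : ℝ)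
    (A : InfSignal E) (x₀ : E) : Prop :=
  x₀ ≠ 0 ∧ A ∈ weakStarClosure (Finfty F) ∧
    ∀ t : ℝ≥0, 1 / C * mu F ^ (t : ℝ) * ‖x₀‖ ≤ ‖flow A t x₀‖ ∧
      ‖flow A t x₀‖ ≤ C * mu F ^ (t : ℝ) * ‖x₀‖

end SwitchedSystem

end

/-! Everything rests on two opposite estimates, collected in `IsRegularSemigroup`: `Φ(F_t)` is
`O(μ^t)` (quasi-extremality), and it is not uniformly `o(μ^t)` as `t → ∞` (`not_small`).

The upper estimate (`quasiExtremal_of_irreducible`) comes from irreducibility. The vectors whose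
orbits are `O(μ^t)` form an invariant subspace. Were it zero, compactness of the sphere would double
every vector relative to `μ^t` within a uniform time, and iterating would produce a growth rate
above `μ`. So it is the whole space, and Banach–Steinhaus makes the constant uniform.

The lower estimate (`Fat.not_small`) comes from fatness. Elements of `Φ(F)` can be multiplied but
not cut, whereas signals of `S` can be cut, by shift invariance. If `Φ(F_t)` were `o(μ^t)`, fatness
would bound the flows of `S` at some time `T` by `μ^T / 2`, hence give them a growth rate below `μ`.
But periodic extension turns each element of `Φ(F_t)`, `t > 0`, into the flow of a signal in `F_∞ ⊆
S`: a contradiction.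

By compactness the limit set then contains a nonzero matrix, and its algebraic properties pass to
the limit. Its common kernel is invariant, so trivial, and `v̂` is a norm; `v̂` is extremal because
`μ^{-t} Q T` stays in the limit set. Equivalence of `v̂` with the given norm yields the
quasi-Barabanov property.

For trajectories, a signal along which `x₀` grows like `μ^T` at a late time `T` must do so at all
earlier times, since the remaining piece contributes at most a constant times `μ^(T-t)`. Letting `T
→ ∞` along an ultrafilter, weak-star continuity of the flow (`tendsto_flow`) preserves the bounds.
-/

namespace SwitchedSystem

/-! ### Linear integral equations: Grönwall and the Dyson series -/

section

/-- Grönwall's inequality for solutions of an integral equation. -/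
theorem norm_le_exp_of_integral_eq {G : Type*} [NormedAddCommGroup G] [NormedSpace ℝ G]
    {z f : ℝ → G} {z₀ : G} {M T : ℝ} (hz : ContinuousOn z (Set.Icc 0 T))
    (heq : ∀ s ∈ Set.Icc 0 T, z s = z₀ + ∫ r in (0 : ℝ)..s, f r)
    (hf : ∀ r ∈ Set.Icc 0 T, ‖f r‖ ≤ M * ‖z r‖) {s : ℝ} (hs : s ∈ Set.Icc 0 T) :
    ‖z s‖ ≤ ‖z₀‖ * Real.exp (M * s) := by
  have hT : 0 ≤ T := hs.1.trans hs.2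
  set u : ℝ → ℝ := fun r => ‖z (max 0 (min r T))‖ with hu
  have huc : Continuous u := by
    refine continuous_norm.comp (hz.comp_continuous (by fun_prop) fun r => ?_)
    exact ⟨le_max_left _ _, max_le hT (min_le_right _ _)⟩
  have hueq : ∀ r ∈ Set.Icc 0 T, u r = ‖z r‖ := fun r hr => by
    simp [hu, min_eq_left hr.2, max_eq_right hr.1]
  set v : ℝ → ℝ := fun x => ‖z₀‖ + ∫ r in (0 : ℝ)..x, M * u r with hv
  have hvd : ∀ x, HasDerivAt v (M * u x) x := fun x =>
    (intervalIntegral.integral_hasDerivAt_right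
      ((continuous_const.mul huc).intervalIntegrable _ _)
      ((continuous_const.mul huc).stronglyMeasurableAtFilter _ _)
      (continuous_const.mul huc).continuousAt).const_add _
  have hzv : ∀ x ∈ Set.Icc 0 T, ‖z x‖ ≤ v x := fun x hx => by
    rw [heq x hx]
    refine (norm_add_le _ _).trans (add_le_add le_rfl ?_)
    refine intervalIntegral.norm_integral_le_of_norm_le hx.1 (.of_forall fun r hr => ?_)
      ((continuous_const.mul huc).intervalIntegrable _ _)
    have hr' : r ∈ Set.Icc 0 T := ⟨hr.1.le, hr.2.trans hx.2⟩
    simpa [hueq r hr'] using hf r hr'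
  have hMu : ∀ x ∈ Set.Icc 0 T, 0 ≤ M * u x := fun x hx => by
    rw [hueq x hx]; exact (norm_nonneg _).trans (hf x hx)
  rcases le_or_gt 0 M with hM | hM
  · have key := norm_le_gronwallBound_of_norm_deriv_right_le (f := v) (f' := fun x => M * u x)
      (δ := ‖z₀‖) (K := M) (ε := 0) (a := 0) (b := T)
      (fun x _ => (hvd x).continuousAt.continuousWithinAt)
      (fun x _ => (hvd x).hasDerivWithinAt) (by simp [hv])
      (fun x hx => by
        have hx' : x ∈ Set.Icc 0 T := ⟨hx.1, hx.2.le⟩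
        rw [add_zero, Real.norm_of_nonneg (hMu x hx')]
        refine mul_le_mul_of_nonneg_left ?_ hM
        rw [hueq x hx']
        exact (hzv x hx').trans (le_abs_self _)) s hs
    rw [gronwallBound_ε0, sub_zero] at key
    exact (hzv s hs).trans ((le_abs_self _).trans key)
  · have : ‖z s‖ ≤ 0 := by
      have := (norm_nonneg _).trans (hf s hs)
      by_contra h
      nlinarith
    exact this.trans (by positivity)

theorem intervalIntegrable_of_norm_le {G : Type*} [NormedAddCommGroup G] {a : ℝ → G} {M : ℝ}
    (ha : StronglyMeasurable a) (hM : ∀ τ, ‖a τ‖ ≤ M) (s t : ℝ) :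
    IntervalIntegrable a volume s t :=
  (intervalIntegrable_const (c := M)).mono_fun ha.aestronglyMeasurable
    (.of_forall fun τ => (hM τ).trans (le_abs_self _))

theorem intervalIntegrable_mul_of_norm_le {𝔸 : Type*} [NormedRing 𝔸] {a : ℝ → 𝔸} {M : ℝ}
    (ha : StronglyMeasurable a)
    (hM : ∀ τ, ‖a τ‖ ≤ M) {z : ℝ → 𝔸} {s t : ℝ} (hz : ContinuousOn z (Set.uIcc s t)) :
    IntervalIntegrable (fun r => a r * z r) volume s t :=
  (intervalIntegrable_of_norm_le ha hM s t).mul_continuousOn hz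

variable {𝔸 : Type*} [NormedRing 𝔸] [NormedAlgebra ℝ 𝔸]

/-- The terms of the Dyson series of `Ψ' = a Ψ`, `Ψ(0) = 1`. -/
noncomputable def dyson (a : ℝ → 𝔸) : ℕ → ℝ → 𝔸
  | 0 => fun _ => 1
  | n + 1 => fun t => ∫ r in (0 : ℝ)..t, a r * dyson a n r

theorem continuous_dyson {a : ℝ → 𝔸} {M : ℝ} (ha : StronglyMeasurable a) (hM : ∀ τ, ‖a τ‖ ≤ M)
    (n : ℕ) : Continuous (dyson a n) := by
  induction n with
  | zero => exact continuous_const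
  | succ n ih =>
    exact intervalIntegral.continuous_primitive
      (fun s t => intervalIntegrable_mul_of_norm_le ha hM ih.continuousOn) 0

theorem norm_dyson_le {a : ℝ → 𝔸} {M : ℝ} (hM : ∀ τ, ‖a τ‖ ≤ M) (n : ℕ) {t : ℝ} (ht : 0 ≤ t) :
    ‖dyson a n t‖ ≤ ‖(1 : 𝔸)‖ * ((M * t) ^ n / n.factorial) := by
  have hM0 : 0 ≤ M := (norm_nonneg _).trans (hM 0)
  induction n generalizing t with
  | zero => simp [dyson]
  | succ n ih =>
    have h1 : ‖dyson a (n + 1) t‖ ≤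
        ∫ r in (0 : ℝ)..t, M * (‖(1 : 𝔸)‖ * ((M * r) ^ n / n.factorial)) := by
      refine intervalIntegral.norm_integral_le_of_norm_le ht (.of_forall fun r hr => ?_)
        (Continuous.intervalIntegrable (by fun_prop) _ _)
      exact (norm_mul_le _ _).trans
        (mul_le_mul (hM r) (ih hr.1.le) (norm_nonneg _) hM0)
    refine h1.trans (le_of_eq ?_)
    have : ∀ r : ℝ, M * (‖(1 : 𝔸)‖ * ((M * r) ^ n / n.factorial))
        = (M ^ (n + 1) * ‖(1 : 𝔸)‖ / n.factorial) * r ^ n := fun r => by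
      rw [mul_pow]; ring
    simp_rw [this]
    rw [intervalIntegral.integral_const_mul, integral_pow, Nat.factorial_succ]
    have : (n.factorial : ℝ) ≠ 0 := by positivity
    have : (n : ℝ) + 1 ≠ 0 := by positivity
    push_cast
    field_simp
    ring

/-- The factorial bound makes the Dyson series converge uniformly on all of `[0,T]`, so it can be
integrated term by term, and integration shifts the series by one index. -/
theorem exists_solution [CompleteSpace 𝔸] {a : ℝ → 𝔸} {M : ℝ} (ha : StronglyMeasurable a)
    (hM : ∀ τ, ‖a τ‖ ≤ M) (T : ℝ) :
    ∃ Ψ : ℝ → 𝔸, ContinuousOn Ψ (Set.Icc 0 T) ∧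
      ∀ τ ∈ Set.Icc 0 T, Ψ τ = 1 + ∫ r in (0 : ℝ)..τ, a r * Ψ r := by
  have hM0 : 0 ≤ M := (norm_nonneg _).trans (hM 0)
  set b : ℕ → ℝ := fun n => ‖(1 : 𝔸)‖ * ((M * T) ^ n / n.factorial) with hb
  have hbs : Summable b := (Real.summable_pow_div_factorial (M * T)).mul_left _
  have hbound : ∀ n, ∀ t ∈ Set.Icc 0 T, ‖dyson a n t‖ ≤ b n := fun n t ht => by
    refine (norm_dyson_le hM n ht.1).trans ?_
    have := ht.1
    have := ht.2
    simp only [hb]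
    gcongr
  refine ⟨fun t => ∑' n, dyson a n t, continuousOn_tsum
    (fun n => (continuous_dyson ha hM n).continuousOn) hbs hbound, fun τ hτ => ?_⟩
  have hs : ∀ t ∈ Set.Icc 0 T, Summable fun n => dyson a n t := fun t ht =>
    Summable.of_norm_bounded hbs fun n => hbound n t ht
  have hsub : ∀ r ∈ Set.uIoc 0 τ, r ∈ Set.Icc 0 T := fun r hr => by
    rw [Set.uIoc_of_le hτ.1] at hr
    exact ⟨hr.1.le, hr.2.trans hτ.2⟩
  have key : HasSum (fun n => dyson a (n + 1) τ)
      (∫ r in (0 : ℝ)..τ, a r * ∑' n, dyson a n r) := by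
    refine intervalIntegral.hasSum_integral_of_dominated_convergence (fun n _ => M * b n)
      (fun n => ?_) (fun n => .of_forall fun r hr => ?_)
      (.of_forall fun r _ => hbs.mul_left M) intervalIntegrable_const
      (.of_forall fun r hr => (hs r (hsub r hr)).hasSum.mul_left _)
    · exact (ha.mul (continuous_dyson ha hM n).stronglyMeasurable).aestronglyMeasurable
    · exact (norm_mul_le _ _).trans
        (mul_le_mul (hM r) (hbound n r (hsub r hr)) (norm_nonneg _) hM0)
  beta_reduce
  rw [(hs τ hτ).tsum_eq_zero_add, key.tsum_eq]
  rfl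

end

/-! ### The flow of a bounded signal -/

section

/-- Solutions of `z' = a z` with the same initial value agree. -/
theorem eq_of_integral_eq {𝔸 : Type*} [NormedRing 𝔸] [NormedAlgebra ℝ 𝔸] {a : ℝ → 𝔸} {M : ℝ}
    (ha : StronglyMeasurable a) (hM : ∀ τ, ‖a τ‖ ≤ M) {z w : ℝ → 𝔸} {z₀ : 𝔸} {T : ℝ}
    (hz : ContinuousOn z (Set.Icc 0 T)) (hw : ContinuousOn w (Set.Icc 0 T))
    (hz' : ∀ s ∈ Set.Icc 0 T, z s = z₀ + ∫ r in (0 : ℝ)..s, a r * z r)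
    (hw' : ∀ s ∈ Set.Icc 0 T, w s = z₀ + ∫ r in (0 : ℝ)..s, a r * w r)
    {s : ℝ} (hs : s ∈ Set.Icc 0 T) : z s = w s := by
  have hsub : ∀ s ∈ Set.Icc 0 T, Set.uIcc 0 s ⊆ Set.Icc 0 T := fun s hs => by
    rw [Set.uIcc_of_le hs.1]; exact Set.Icc_subset_Icc le_rfl hs.2
  have key := norm_le_exp_of_integral_eq (z := fun s => z s - w s)
    (f := fun r => a r * (z r - w r)) (z₀ := 0) (M := M) (hz.sub hw)
    (fun s hs => by
      simp_rw [mul_sub]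
      rw [hz' s hs, hw' s hs, intervalIntegral.integral_sub
        (intervalIntegrable_mul_of_norm_le ha hM (hz.mono (hsub s hs)))
        (intervalIntegrable_mul_of_norm_le ha hM (hw.mono (hsub s hs)))]
      abel)
    (fun r _ => (norm_mul_le _ _).trans (mul_le_mul_of_nonneg_right (hM r) (norm_nonneg _))) hs
  simpa [sub_eq_zero] using key

variable {E : Type*} [NormedAddCommGroup E] [NormedSpace ℝ E]

/-- A strongly measurable signal, bounded by `M` everywhere. -/
structure IsBddSignal (M : ℝ) (a : ℝ → Mat E) : Prop where
  meas : StronglyMeasurable a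
  norm_le : ∀ τ, ‖a τ‖ ≤ M

theorem IsBddSignal.nonneg {M : ℝ} {a : ℝ → Mat E} (ha : IsBddSignal M a) : 0 ≤ M :=
  (norm_nonneg _).trans (ha.norm_le 0)

theorem IsBddSignal.shift {M : ℝ} {a : ℝ → Mat E} (ha : IsBddSignal M a) (s : ℝ) :
    IsBddSignal M fun τ => a (s + τ) :=
  ⟨ha.meas.comp_measurable (measurable_const_add s), fun _ => ha.norm_le _⟩

theorem IsBddSignal.concat {M : ℝ} {a b : ℝ → Mat E} (ha : IsBddSignal M a)
    (hb : IsBddSignal M b) (s : ℝ) : IsBddSignal M (concat s a b) := by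
  refine ⟨StronglyMeasurable.ite measurableSet_Iic ha.meas
    (hb.meas.comp_measurable (measurable_id.sub_const s)), fun τ => ?_⟩
  unfold SwitchedSystem.concat
  split_ifs
  exacts [ha.norm_le _, hb.norm_le _]

/-- Flows see only the a.e. class of a signal, so one may always compute with a measurable
representative that is bounded everywhere. -/
theorem exists_isBddSignal_ae_eq {μ : Measure ℝ} {f : ℝ → Mat E} {M : ℝ} (hM : 0 ≤ M)
    (hf : AEStronglyMeasurable f μ) (hb : ∀ᵐ τ ∂μ, ‖f τ‖ ≤ M) :
    ∃ a, IsBddSignal M a ∧ f =ᵐ[μ] a := by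
  have hs : MeasurableSet {τ | ‖hf.mk f τ‖ ≤ M} :=
    hf.stronglyMeasurable_mk.norm.measurableSet_le stronglyMeasurable_const
  refine ⟨{τ | ‖hf.mk f τ‖ ≤ M}.indicator (hf.mk f),
    ⟨hf.stronglyMeasurable_mk.indicator hs, fun τ => ?_⟩, ?_⟩
  · by_cases h : ‖hf.mk f τ‖ ≤ M
    · rwa [Set.indicator_of_mem (show τ ∈ {τ | ‖hf.mk f τ‖ ≤ M} from h)]
    · rwa [Set.indicator_of_notMem (show τ ∉ {τ | ‖hf.mk f τ‖ ≤ M} from h), norm_zero]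
  · filter_upwards [hb, hf.ae_eq_mk] with τ h1 h2
    rw [h2] at h1
    rw [Set.indicator_of_mem (show τ ∈ {τ | ‖hf.mk f τ‖ ≤ M} from h1), h2]

/-- Stated as an equality of predicates because `flow` is a choice depending on the predicate: equal
predicates give the same chosen solution, with no appeal to uniqueness. -/
theorem isFundamentalSolution_congr {A B : ℝ → Mat E} {t : ℝ}
    (h : A =ᵐ[volume.restrict (Set.Icc 0 t)] B) :
    IsFundamentalSolution A t = IsFundamentalSolution B t := by
  funext Ψ
  refine propext (and_congr_right fun _ => forall₂_congr fun τ hτ => ?_)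
  have : ∫ r in (0 : ℝ)..τ, A r * Ψ r = ∫ r in (0 : ℝ)..τ, B r * Ψ r := by
    refine intervalIntegral.integral_congr_ae_restrict ?_
    have hsub : Set.uIoc 0 τ ⊆ Set.Icc 0 t := fun r hr => by
      rw [Set.uIoc_of_le hτ.1] at hr
      exact ⟨hr.1.le, hr.2.trans hτ.2⟩
    filter_upwards [ae_restrict_of_ae_restrict_of_subset hsub h] with r hr
    rw [hr]
  rw [this]

open Classical in
theorem flow_congr {A B : ℝ → Mat E} {t : ℝ} (h : A =ᵐ[volume.restrict (Set.Icc 0 t)] B) :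
    flow A t = flow B t := by
  let g : ((ℝ → Mat E) → Prop) → Mat E := fun P => if h : ∃ Ψ, P Ψ then h.choose t else 0
  exact congrArg g (isFundamentalSolution_congr h)

theorem flow_zero (A : ℝ → Mat E) : flow A 0 = 1 := by
  have h : ∃ Ψ, IsFundamentalSolution A 0 Ψ :=
    ⟨fun _ => 1, continuousOn_const, fun τ hτ => by
      rw [Set.Icc_self] at hτ
      rw [Set.mem_singleton_iff.1 hτ]
      simp⟩
  rw [flow, dif_pos h, h.choose_spec.2 0 (by simp)]
  simp

variable [CompleteSpace E]

/-- `flow a s` comes from a separate choice for each `s`; uniqueness glues these values into a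
single solution. -/
theorem IsBddSignal.flow_eq {M : ℝ} {a : ℝ → Mat E} (ha : IsBddSignal M a) {t : ℝ}
    {Ψ : ℝ → Mat E} (hΨ : IsFundamentalSolution a t Ψ) {s : ℝ} (hs : s ∈ Set.Icc 0 t) :
    flow a s = Ψ s := by
  have h : ∃ Ψ, IsFundamentalSolution a s Ψ := exists_solution ha.meas ha.norm_le s
  rw [flow, dif_pos h]
  have hsub : Set.Icc 0 s ⊆ Set.Icc 0 t := Set.Icc_subset_Icc le_rfl hs.2
  exact eq_of_integral_eq ha.meas ha.norm_le h.choose_spec.1 (hΨ.1.mono hsub) h.choose_spec.2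
    (fun r hr => hΨ.2 r (hsub hr)) ⟨hs.1, le_rfl⟩

theorem IsBddSignal.flow_spec {M : ℝ} {a : ℝ → Mat E} (ha : IsBddSignal M a) (t : ℝ) :
    IsFundamentalSolution a t (flow a) := by
  obtain ⟨Ψ, hΨ⟩ : ∃ Ψ, IsFundamentalSolution a t Ψ := exists_solution ha.meas ha.norm_le t
  refine ⟨hΨ.1.congr fun s hs => ha.flow_eq hΨ hs, fun s hs => ?_⟩
  rw [ha.flow_eq hΨ hs, hΨ.2 s hs]
  congr 1
  refine intervalIntegral.integral_congr fun r hr => ?_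
  rw [Set.uIcc_of_le hs.1] at hr
  rw [ha.flow_eq hΨ ⟨hr.1, hr.2.trans hs.2⟩]

theorem IsBddSignal.norm_flow_le {M : ℝ} {a : ℝ → Mat E} (ha : IsBddSignal M a) {t : ℝ}
    (ht : 0 ≤ t) : ‖flow a t‖ ≤ Real.exp (M * t) := by
  have h := ha.flow_spec t
  have := norm_le_exp_of_integral_eq h.1 h.2
    (fun r _ => (norm_mul_le _ _).trans (mul_le_mul_of_nonneg_right (ha.norm_le r) (norm_nonneg _)))
    ⟨ht, le_rfl⟩
  exact this.trans (mul_le_of_le_one_left (Real.exp_nonneg _) ContinuousLinearMap.norm_id_le)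

/-- Grönwall for the time-reversed trajectory `s ↦ flow a (t - s) x`. It gives invertibility of
flows and, later, positivity of `mu F`. -/
theorem IsBddSignal.norm_le_exp_mul_norm_flow_apply {M : ℝ} {a : ℝ → Mat E}
    (ha : IsBddSignal M a) {t : ℝ} (ht : 0 ≤ t) (x : E) :
    ‖x‖ ≤ Real.exp (M * t) * ‖flow a t x‖ := by
  have h := ha.flow_spec t
  set f : ℝ → E := fun r => a r (flow a r x) with hf
  have hint : ∀ s ∈ Set.Icc 0 t, ∀ u ∈ Set.Icc 0 t,
      IntervalIntegrable (fun r => a r * flow a r) volume s u := fun s hs u hu =>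
    intervalIntegrable_mul_of_norm_le ha.meas ha.norm_le
      (h.1.mono (Set.uIcc_subset_Icc hs hu))
  have hfint : ∀ s ∈ Set.Icc 0 t, ∀ u ∈ Set.Icc 0 t, IntervalIntegrable f volume s u :=
    fun s hs u hu => ⟨(ContinuousLinearMap.apply ℝ E x).integrable_comp (hint s hs u hu).1,
      (ContinuousLinearMap.apply ℝ E x).integrable_comp (hint s hs u hu).2⟩
  have h0 : (0 : ℝ) ∈ Set.Icc 0 t := ⟨le_rfl, ht⟩
  have hy : ∀ s ∈ Set.Icc 0 t, flow a s x = x + ∫ r in (0 : ℝ)..s, f r := fun s hs => by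
    conv_lhs => rw [h.2 s hs]
    have := (ContinuousLinearMap.apply ℝ E x).intervalIntegral_comp_comm (hint 0 h0 s hs)
    simp only [ContinuousLinearMap.apply_apply, mul_apply_eq_comp] at this
    simp [hf, this]
  have hmap : ∀ s ∈ Set.Icc 0 t, t - s ∈ Set.Icc 0 t := fun s hs =>
    ⟨by linarith [hs.2], by linarith [hs.1]⟩
  have key := norm_le_exp_of_integral_eq (z := fun s => flow a (t - s) x)
    (f := fun r => -f (t - r)) (z₀ := flow a t x) (M := M) (T := t)
    ((h.1.comp (by fun_prop) hmap).clm_apply continuousOn_const)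
    (fun s hs => by
      rw [intervalIntegral.integral_neg, intervalIntegral.integral_comp_sub_left, sub_zero,
        hy _ (hmap s hs), hy t ⟨ht, le_rfl⟩,
        ← intervalIntegral.integral_add_adjacent_intervals (hfint 0 h0 _ (hmap s hs))
          (hfint _ (hmap s hs) t ⟨ht, le_rfl⟩)]
      abel)
    (fun r _ => by
      rw [norm_neg]
      exact (ContinuousLinearMap.le_opNorm _ _).trans
        (mul_le_mul_of_nonneg_right (ha.norm_le _) (norm_nonneg _)))
    (s := t) ⟨ht, le_rfl⟩
  rw [sub_self, flow_zero] at key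
  simpa [mul_comm] using key

/-- As functions of `t`, both sides solve the shifted equation with initial value `flow a s`. -/
theorem IsBddSignal.flow_add {M : ℝ} {a : ℝ → Mat E} (ha : IsBddSignal M a) {s t : ℝ}
    (hs : 0 ≤ s) (ht : 0 ≤ t) :
    flow a (s + t) = flow (fun τ => a (s + τ)) t * flow a s := by
  have h := ha.flow_spec (s + t)
  have h' := (ha.shift s).flow_spec t
  have hmap : ∀ r ∈ Set.Icc 0 t, s + r ∈ Set.Icc 0 (s + t) := fun r hr =>
    ⟨by linarith [hr.1], by linarith [hr.2]⟩
  have hs' : s ∈ Set.Icc 0 (s + t) := ⟨hs, by linarith⟩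
  have hint : ∀ u ∈ Set.Icc 0 (s + t), ∀ v ∈ Set.Icc 0 (s + t),
      IntervalIntegrable (fun r => a r * flow a r) volume u v := fun u hu v hv =>
    intervalIntegrable_mul_of_norm_le ha.meas ha.norm_le
      (h.1.mono (Set.uIcc_subset_Icc hu hv))
  refine eq_of_integral_eq (z := fun τ => flow a (s + τ))
    (w := fun τ => flow (fun τ => a (s + τ)) τ * flow a s) (z₀ := flow a s)
    (ha.shift s).meas (ha.shift s).norm_le (h.1.comp (by fun_prop) hmap)
    (h'.1.mul continuousOn_const) (fun u hu => ?_) (fun u hu => ?_) (s := t) ⟨ht, le_rfl⟩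
  · rw [intervalIntegral.integral_comp_add_left (fun r => a r * flow a r), add_zero,
      h.2 _ (hmap u hu), h.2 s hs', add_assoc,
      intervalIntegral.integral_add_adjacent_intervals
        (hint 0 ⟨le_rfl, by linarith⟩ s hs') (hint s hs' _ (hmap u hu))]
  · simp_rw [← mul_assoc]
    rw [h'.2 u hu, add_mul, one_mul]
    congr 1
    have hi : IntervalIntegrable (fun r => a (s + r) * flow (fun τ => a (s + τ)) r)
        volume 0 u :=
      intervalIntegrable_mul_of_norm_le (ha.shift s).meas (ha.shift s).norm_le
        (h'.1.mono (Set.uIcc_subset_Icc ⟨le_rfl, ht⟩ hu))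
    exact (((ContinuousLinearMap.mul ℝ (Mat E)).flip (flow a s)).intervalIntegral_comp_comm
      hi).symm

theorem IsBddSignal.flow_concat {M : ℝ} {a b : ℝ → Mat E} (ha : IsBddSignal M a)
    (hb : IsBddSignal M b) {s t : ℝ} (hs : 0 ≤ s) (ht : 0 ≤ t) :
    flow (SwitchedSystem.concat s a b) (s + t) = flow b t * flow a s := by
  rw [(ha.concat hb s).flow_add hs ht]
  congr 1
  · refine flow_congr ?_
    -- At the junction the concatenation takes the value of `a`, not of `b`; this is one point.
    have : ∀ᵐ τ ∂(volume.restrict (Set.Icc 0 t)), τ ≠ 0 :=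
      ae_restrict_of_ae (by simp [ae_iff])
    filter_upwards [this, ae_restrict_mem measurableSet_Icc] with τ h0 hτ
    have : 0 < τ := lt_of_le_of_ne hτ.1 (Ne.symm h0)
    simp [SwitchedSystem.concat, not_le.2 this]
  · refine flow_congr ?_
    filter_upwards [ae_restrict_mem measurableSet_Icc] with τ hτ
    simp [SwitchedSystem.concat, hτ.2]

theorem IsBddSignal.isUnit_flow [FiniteDimensional ℝ E] {M : ℝ} {a : ℝ → Mat E}
    (ha : IsBddSignal M a) {t : ℝ} (ht : 0 ≤ t) : IsUnit (flow a t) := by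
  have hinj : Function.Injective (flow a t) :=
    (injective_iff_map_eq_zero _).2 fun x hx => by
      have := ha.norm_le_exp_mul_norm_flow_apply ht x
      rw [hx, norm_zero, mul_zero] at this
      exact norm_le_zero_iff.1 this
  let e := (LinearEquiv.ofInjectiveEndo (flow a t : E →ₗ[ℝ] E) hinj).toContinuousLinearEquiv
  exact ⟨ContinuousLinearEquiv.toUnit e, by ext x; rfl⟩

end

/-! ### Weak-star limits of signals and continuity of the flow -/

section

section WeakLimit

variable {ι G : Type*} [NormedAddCommGroup G] [NormedSpace ℝ G]

theorem integrableOn_of_norm_le {G : Type*} [NormedAddCommGroup G] {a : ℝ → G} {M : ℝ}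
    (ha : StronglyMeasurable a)
    (hM : ∀ τ, ‖a τ‖ ≤ M) {s : Set ℝ} (hs : volume s ≠ ∞) : IntegrableOn a s :=
  Measure.integrableOn_of_bounded hs ha.aestronglyMeasurable (.of_forall hM)

theorem integrable_indicator_of_integrableOn {G : Type*} [NormedAddCommGroup G] {f : ℝ → G}
    {s : Set ℝ} (hf : IntegrableOn f s) (hs : MeasurableSet s) : Integrable (s.indicator f) :=
  hf.integrable_indicator hs

theorem exists_tendsto_of_norm_le [FiniteDimensional ℝ G] (l : Ultrafilter ι) {f : ι → G} {C : ℝ}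
    (h : ∀ k, ‖f k‖ ≤ C) : ∃ x, ‖x‖ ≤ C ∧ Tendsto f l (𝓝 x) := by
  have : ProperSpace G := FiniteDimensional.proper ℝ G
  obtain ⟨x, hx, hl⟩ := (isCompact_closedBall (0 : G) C).ultrafilter_le_nhds' (l.map f)
    (Filter.mem_map.2 (univ_mem' fun k => by simpa using h k))
  exact ⟨x, by simpa using hx, hl⟩

theorem norm_deriv_le_of_lipschitzWith {P : ℝ → G} {K : ℝ≥0} (hP : LipschitzWith K P) (τ : ℝ) :
    ‖deriv P τ‖ ≤ K :=
  norm_deriv_le_of_lipschitz hP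

/-- `P` minus the primitive of its derivative is absolutely continuous with derivative zero a.e.,
hence constant. -/
theorem integral_deriv_eq_sub_of_lipschitzWith [FiniteDimensional ℝ G] {P : ℝ → G} {K : ℝ≥0}
    (hP : LipschitzWith K P) (s t : ℝ) : ∫ r in s..t, deriv P r = P t - P s := by
  have : CompleteSpace G := FiniteDimensional.complete ℝ G
  have hDi : ∀ s t, IntervalIntegrable (deriv P) volume s t :=
    intervalIntegrable_of_norm_le (stronglyMeasurable_deriv P)
      (norm_deriv_le_of_lipschitzWith hP)
  have hac : AbsolutelyContinuousOnInterval (fun x => P x - ∫ r in s..x, deriv P r) s t :=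
    (hP.lipschitzOnWith.absolutelyContinuousOnInterval).sub
      (LipschitzWith.of_dist_le_mul (K := K) fun x y => by
        rw [dist_eq_norm, Real.dist_eq,
          intervalIntegral.integral_interval_sub_left (hDi s x) (hDi s y)]
        exact intervalIntegral.norm_integral_le_of_norm_le_const fun r _ =>
          norm_deriv_le_of_lipschitzWith hP r).lipschitzOnWith.absolutelyContinuousOnInterval
  have hd : ∀ᵐ x, x ∈ Set.uIcc s t →
      HasDerivAt (fun x => P x - ∫ r in s..x, deriv P r) 0 x := by
    filter_upwards [hP.ae_differentiableAt_real, (hDi s t).ae_hasDerivAt_integral] with x hx₁ hx₂ hx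
    have := hx₁.hasDerivAt.sub (hx₂ hx s Set.left_mem_uIcc)
    rw [sub_self] at this
    exact this
  obtain ⟨c, hc⟩ := hac.const_of_ae_hasDerivAt_zero hd
  have h1 := hc s Set.left_mem_uIcc
  have h2 := hc t Set.right_mem_uIcc
  rw [intervalIntegral.integral_same, sub_zero] at h1
  rw [← h1] at h2
  rw [← h2]
  abel

theorem integrable_clm_apply_of_norm_le {H : Type*} [NormedAddCommGroup H] [NormedSpace ℝ H]
    {A : ℝ → G} {M : ℝ} {f : ℝ → G →L[ℝ] H} (hf : Integrable f)
    (hA : StronglyMeasurable A) (hAM : ∀ τ, ‖A τ‖ ≤ M) : Integrable fun r => f r (A r) :=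
  (hf.norm.mul_const M).mono' 
    (isBoundedBilinearMap_apply.continuous.comp_aestronglyMeasurable
      (hf.aestronglyMeasurable.prodMk hA.aestronglyMeasurable))
    (.of_forall fun r => (f r).le_opNorm_of_le (hAM r))

theorem norm_integral_clm_apply_sub_le {H : Type*} [NormedAddCommGroup H] [NormedSpace ℝ H]
    {A : ℝ → G} {M : ℝ} {f g : ℝ → G →L[ℝ] H} (hf : Integrable f)
    (hg : Integrable g) (hA : StronglyMeasurable A) (hAM : ∀ τ, ‖A τ‖ ≤ M) :
    ‖(∫ r, f r (A r)) - ∫ r, g r (A r)‖ ≤ (∫ r, ‖f r - g r‖) * M := by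
  rw [← integral_sub (integrable_clm_apply_of_norm_le hf hA hAM)
    (integrable_clm_apply_of_norm_le hg hA hAM), ← integral_mul_const]
  exact norm_integral_le_of_norm_le ((hf.sub hg).norm.mul_const M)
    (.of_forall fun r => by simpa using (f r - g r).le_opNorm_of_le (hAM r))

/-- A bounded family of signals has, along an ultrafilter, a limit in the sense of integrals over
intervals: the derivative of the limit of the primitives. -/
theorem exists_tendsto_intervalIntegral [FiniteDimensional ℝ G] (l : Ultrafilter ι)
    {a : ι → ℝ → G} {M : ℝ} (hM0 : 0 ≤ M) (ha : ∀ k, StronglyMeasurable (a k))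
    (hM : ∀ k τ, ‖a k τ‖ ≤ M) :
    ∃ A : ℝ → G, StronglyMeasurable A ∧ (∀ τ, ‖A τ‖ ≤ M) ∧
      ∀ s t, Tendsto (fun k => ∫ r in s..t, a k r) l (𝓝 (∫ r in s..t, A r)) := by
  have : CompleteSpace G := FiniteDimensional.complete ℝ G
  have hbd : ∀ k s t, ‖∫ r in s..t, a k r‖ ≤ M * |t - s| := fun k s t =>
    intervalIntegral.norm_integral_le_of_norm_le_const fun r _ => hM k r
  have hi : ∀ k s t, IntervalIntegrable (a k) volume s t := fun k =>
    intervalIntegrable_of_norm_le (ha k) (hM k)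
  have hex : ∀ t, ∃ x, Tendsto (fun k => ∫ r in (0 : ℝ)..t, a k r) l (𝓝 x) := fun t =>
    let ⟨x, _, hx⟩ := exists_tendsto_of_norm_le l (fun k => hbd k 0 t)
    ⟨x, hx⟩
  choose P hP using hex
  have hPsub : ∀ s t, Tendsto (fun k => ∫ r in s..t, a k r) l (𝓝 (P t - P s)) := fun s t => by
    refine ((hP t).sub (hP s)).congr fun k => ?_
    exact intervalIntegral.integral_interval_sub_left (hi k 0 t) (hi k 0 s)
  have hLip : LipschitzWith M.toNNReal P := LipschitzWith.of_dist_le_mul fun t s => by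
    rw [dist_eq_norm, Real.dist_eq, Real.coe_toNNReal _ hM0]
    exact le_of_tendsto (hPsub s t).norm (.of_forall fun k => hbd k s t)
  have hDb := norm_deriv_le_of_lipschitzWith hLip
  rw [Real.coe_toNNReal _ hM0] at hDb
  refine ⟨deriv P, stronglyMeasurable_deriv P, hDb, fun s t => ?_⟩
  rw [integral_deriv_eq_sub_of_lipschitzWith hLip]
  exact hPsub s t

variable [CompleteSpace G] {l : Filter ι} {a : ι → ℝ → G} {A : ℝ → G} {M : ℝ}

/-- Dominated convergence for series, with `M` times the measure of each piece as summable majorant.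
-/
theorem tendsto_setIntegral_iUnion (ha : ∀ k, StronglyMeasurable (a k))
    (hM : ∀ k τ, ‖a k τ‖ ≤ M) (hA : StronglyMeasurable A) (hAM : ∀ τ, ‖A τ‖ ≤ M)
    {κ : Type*} [Countable κ] {s : κ → Set ℝ} (hs : ∀ i, MeasurableSet (s i))
    (hd : Pairwise (Function.onFun Disjoint s)) (hfin : volume (⋃ i, s i) ≠ ∞)
    (h : ∀ i, Tendsto (fun k => ∫ r in s i, a k r) l (𝓝 (∫ r in s i, A r))) :
    Tendsto (fun k => ∫ r in ⋃ i, s i, a k r) l (𝓝 (∫ r in ⋃ i, s i, A r)) := by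
  have hlt : ∀ i, volume (s i) < ∞ := fun i =>
    (measure_mono (Set.subset_iUnion s i)).trans_lt hfin.lt_top
  have hsum : Summable fun i => M * volume.real (s i) := by
    rw [measure_iUnion hd hs] at hfin
    exact (ENNReal.summable_toReal hfin).mul_left M
  rw [integral_iUnion hs hd (integrableOn_of_norm_le hA hAM hfin)]
  simp_rw [integral_iUnion hs hd (integrableOn_of_norm_le (ha _) (hM _) hfin)]
  exact tendsto_tsum_of_dominated_convergence hsum h (.of_forall fun k i =>
    norm_setIntegral_le_of_norm_le_const (hlt i) fun r _ => hM k r)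

/-- A π-λ argument from half-lines to Borel sets; the window `Ioc u v` keeps measures finite, so
that complements are differences. -/
theorem tendsto_setIntegral_inter_Ioc (ha : ∀ k, StronglyMeasurable (a k))
    (hM : ∀ k τ, ‖a k τ‖ ≤ M) (hA : StronglyMeasurable A) (hAM : ∀ τ, ‖A τ‖ ≤ M)
    (h : ∀ s t, Tendsto (fun k => ∫ r in s..t, a k r) l (𝓝 (∫ r in s..t, A r)))
    {u v : ℝ} {s : Set ℝ} (hs : MeasurableSet s) :
    Tendsto (fun k => ∫ r in s ∩ Set.Ioc u v, a k r) l (𝓝 (∫ r in s ∩ Set.Ioc u v, A r)) := by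
  have hIoc : ∀ u v : ℝ, Tendsto (fun k => ∫ r in Set.Ioc u v, a k r) l
      (𝓝 (∫ r in Set.Ioc u v, A r)) := fun u v => by
    rcases le_total u v with huv | huv
    · simpa only [intervalIntegral.integral_of_le huv] using h u v
    · simpa [Set.Ioc_eq_empty_of_le huv] using tendsto_const_nhds
  have hlt : ∀ s : Set ℝ, volume (s ∩ Set.Ioc u v) ≠ ∞ := fun s =>
    ((measure_mono Set.inter_subset_right).trans_lt measure_Ioc_lt_top).ne
  induction s, hs using MeasurableSpace.induction_on_inter (borel_eq_generateFrom_Iic ℝ)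
    isPiSystem_Iic with
  | empty => simpa using tendsto_const_nhds
  | basic t ht =>
    obtain ⟨c, rfl⟩ := ht
    have : Set.Iic c ∩ Set.Ioc u v = Set.Ioc u (min v c) := by
      rw [Set.inter_comm, Set.Ioc_inter_Iic]
    rw [this]
    exact hIoc u _
  | compl t ht ih =>
    have key : ∀ {f : ℝ → G}, StronglyMeasurable f → (∀ τ, ‖f τ‖ ≤ M) →
        ∫ r in tᶜ ∩ Set.Ioc u v, f r = (∫ r in Set.Ioc u v, f r) - ∫ r in t ∩ Set.Ioc u v, f r :=
      fun {f} hf hfM => by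
        rw [eq_sub_iff_add_eq', Set.inter_comm t, Set.inter_comm tᶜ, ← Set.sdiff_eq]
        exact integral_inter_add_sdiff ht (integrableOn_of_norm_le hf hfM measure_Ioc_lt_top.ne)
    rw [key hA hAM]
    simp_rw [key (ha _) (hM _)]
    exact (hIoc u v).sub ih
  | iUnion f hd hf ih =>
    have hfin := hlt (⋃ i, f i)
    rw [Set.iUnion_inter] at hfin ⊢
    exact tendsto_setIntegral_iUnion ha hM hA hAM (fun i => (hf i).inter measurableSet_Ioc)
      (fun i j hij => (hd hij).mono Set.inter_subset_left Set.inter_subset_left) hfin ih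

theorem tendsto_setIntegral (ha : ∀ k, StronglyMeasurable (a k))
    (hM : ∀ k τ, ‖a k τ‖ ≤ M) (hA : StronglyMeasurable A) (hAM : ∀ τ, ‖A τ‖ ≤ M)
    (h : ∀ s t, Tendsto (fun k => ∫ r in s..t, a k r) l (𝓝 (∫ r in s..t, A r)))
    {s : Set ℝ} (hs : MeasurableSet s) (hfin : volume s ≠ ∞) :
    Tendsto (fun k => ∫ r in s, a k r) l (𝓝 (∫ r in s, A r)) := by
  have hU : s = ⋃ n : ℤ, s ∩ Set.Ioc (n : ℝ) (n + 1) := by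
    rw [← Set.inter_iUnion, iUnion_Ioc_intCast, Set.inter_univ]
  rw [hU] at hfin ⊢
  refine tendsto_setIntegral_iUnion ha hM hA hAM (fun n => hs.inter measurableSet_Ioc)
    (fun i j hij => ?_) hfin fun n => tendsto_setIntegral_inter_Ioc ha hM hA hAM h hs
  exact (Set.pairwise_disjoint_Ioc_intCast ℝ hij).mono Set.inter_subset_right
    Set.inter_subset_right

variable {H : Type*} [NormedAddCommGroup H] [NormedSpace ℝ H]

/-- Convergence of the integrals over intervals of a bounded family of signals implies weak-star
convergence. -/
theorem tendsto_integral_clm_apply [CompleteSpace H] (hM0 : 0 ≤ M)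
    (ha : ∀ k, StronglyMeasurable (a k))
    (hM : ∀ k τ, ‖a k τ‖ ≤ M) (hA : StronglyMeasurable A) (hAM : ∀ τ, ‖A τ‖ ≤ M)
    (h : ∀ s t, Tendsto (fun k => ∫ r in s..t, a k r) l (𝓝 (∫ r in s..t, A r)))
    {f : ℝ → G →L[ℝ] H} (hf : Integrable f) :
    Tendsto (fun k => ∫ r, f r (a k r)) l (𝓝 (∫ r, f r (A r))) := by
  refine Integrable.induction (P := fun f : ℝ → G →L[ℝ] H =>
    Tendsto (fun k => ∫ r, f r (a k r)) l (𝓝 (∫ r, f r (A r)))) ?_ ?_ ?_ ?_ hf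
  · intro c s hs hfin
    have key : ∀ {f : ℝ → G}, StronglyMeasurable f → (∀ τ, ‖f τ‖ ≤ M) →
        ∫ r, (s.indicator (fun _ => c) r) (f r) = c (∫ r in s, f r) := fun {f} hf hfM => by
      rw [← c.integral_comp_comm (integrableOn_of_norm_le hf hfM hfin.ne),
        ← integral_indicator hs]
      congr 1
      funext r
      by_cases hr : r ∈ s <;> simp [hr]
    rw [key hA hAM]
    simp_rw [key (ha _) (hM _)]
    exact (c.continuous.tendsto _).comp (tendsto_setIntegral ha hM hA hAM h hs hfin.ne)
  · intro f g _ hf hg hf' hg'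
    have key : ∀ {b : ℝ → G}, StronglyMeasurable b → (∀ τ, ‖b τ‖ ≤ M) →
        ∫ r, (f + g) r (b r) = (∫ r, f r (b r)) + ∫ r, g r (b r) := fun {b} hb hbM => by
      rw [← integral_add (integrable_clm_apply_of_norm_le hf hb hbM)
        (integrable_clm_apply_of_norm_le hg hb hbM)]
      rfl
    rw [key hA hAM]
    simp_rw [key (ha _) (hM _)]
    exact hf'.add hg'
  -- The common bound `M` makes the pairings uniformly continuous in `f` for the `L¹` norm, whence
  -- an `ε/3` argument; `M + 1` avoids division by zero.
  · refine isClosed_of_closure_subset fun f hf => Metric.tendsto_nhds.2 fun ε hε => ?_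
    obtain ⟨g, hg, hfg⟩ := Metric.mem_closure_iff.1 hf (ε / (3 * (M + 1))) (by positivity)
    have hclose : ∀ {b : ℝ → G}, StronglyMeasurable b → (∀ τ, ‖b τ‖ ≤ M) →
        dist (∫ r, f r (b r)) (∫ r, g r (b r)) < ε / 3 := fun {b} hb hbM => by
      rw [dist_eq_norm]
      refine (norm_integral_clm_apply_sub_le (L1.integrable_coeFn f) (L1.integrable_coeFn g)
        hb hbM).trans_lt ?_
      have h1 : ∫ r, ‖f r - g r‖ = dist f g := by
        rw [dist_eq_norm, L1.norm_eq_integral_norm]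
        refine integral_congr_ae ?_
        filter_upwards [Lp.coeFn_sub f g] with r hr
        rw [hr]
        rfl
      rw [h1]
      calc dist f g * M ≤ dist f g * (M + 1) := by
            have := dist_nonneg (x := f) (y := g)
            nlinarith
        _ < ε / (3 * (M + 1)) * (M + 1) := by gcongr
        _ = ε / 3 := by field_simp
    filter_upwards [Metric.tendsto_nhds.1 hg (ε / 3) (by positivity)] with k hk
    have h1 := hclose (ha k) (hM k)
    have h2 := hclose hA hAM
    rw [dist_comm] at h2
    calc _ ≤ _ := dist_triangle4 _ (∫ r, g r (a k r)) (∫ r, g r (A r)) _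
      _ < ε := by linarith
  · intro f g hfg _ hf'
    have key : ∀ b : ℝ → G, ∫ r, f r (b r) = ∫ r, g r (b r) := fun b =>
      integral_congr_ae (by filter_upwards [hfg] with r hr; rw [hr])
    simpa only [key] using hf'

theorem tendsto_setIntegral_clm_apply [CompleteSpace H] (hM0 : 0 ≤ M)
    (ha : ∀ k, StronglyMeasurable (a k))
    (hM : ∀ k τ, ‖a k τ‖ ≤ M) (hA : StronglyMeasurable A) (hAM : ∀ τ, ‖A τ‖ ≤ M)
    (h : ∀ s t, Tendsto (fun k => ∫ r in s..t, a k r) l (𝓝 (∫ r in s..t, A r)))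
    {s : Set ℝ} (hs : MeasurableSet s) {f : ℝ → G →L[ℝ] H} (hf : IntegrableOn f s) :
    Tendsto (fun k => ∫ r in s, f r (a k r)) l (𝓝 (∫ r in s, f r (A r))) := by
  have key : ∀ b : ℝ → G, ∫ r, (s.indicator f r) (b r) = ∫ r in s, f r (b r) := fun b => by
    rw [← integral_indicator hs]
    congr 1
    funext r
    by_cases hr : r ∈ s <;> simp [hr]
  have hint : Integrable (s.indicator f) := integrable_indicator_of_integrableOn hf hs
  have := tendsto_integral_clm_apply hM0 ha hM hA hAM h hint
  simpa only [key] using this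

theorem tendsto_intervalIntegral_mul {𝔸 : Type*} [NormedRing 𝔸] [NormedAlgebra ℝ 𝔸]
    [CompleteSpace 𝔸] {a : ι → ℝ → 𝔸} {A Ψ : ℝ → 𝔸} (hM0 : 0 ≤ M)
    (ha : ∀ k, StronglyMeasurable (a k))
    (hM : ∀ k τ, ‖a k τ‖ ≤ M) (hA : StronglyMeasurable A) (hAM : ∀ τ, ‖A τ‖ ≤ M)
    (h : ∀ s t, Tendsto (fun k => ∫ r in s..t, a k r) l (𝓝 (∫ r in s..t, A r)))
    {t : ℝ} (ht : 0 ≤ t) (hΨ : ContinuousOn Ψ (Set.Icc 0 t)) :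
    Tendsto (fun k => ∫ r in (0 : ℝ)..t, a k r * Ψ r) l (𝓝 (∫ r in (0 : ℝ)..t, A r * Ψ r)) := by
  -- Right multiplication by `Ψ r` is an integrable family of operators on `[0,t]`, so it is an
  -- admissible test function.
  set L := (ContinuousLinearMap.mul ℝ 𝔸).flip
  have hint : IntegrableOn (fun r => L (Ψ r)) (Set.Ioc 0 t) :=
    ((L.continuous.comp_continuousOn hΨ).integrableOn_compact isCompact_Icc).mono_set
      Set.Ioc_subset_Icc_self
  simp_rw [intervalIntegral.integral_of_le ht]
  exact tendsto_setIntegral_clm_apply hM0 ha hM hA hAM h measurableSet_Ioc hint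

end WeakLimit

/-- The common Lipschitz constant gives equicontinuity, which upgrades pointwise to uniform
convergence on compact sets. -/
theorem tendstoUniformlyOn_of_lipschitzOnWith {ι X Y : Type*} [PseudoMetricSpace X]
    [PseudoMetricSpace Y] {l : Filter ι} {f : ι → X → Y} {g : X → Y} {K : ℝ≥0} {s : Set X}
    (hs : IsCompact s) (hf : ∀ k, LipschitzOnWith K (f k) s)
    (h : ∀ x ∈ s, Tendsto (f · x) l (𝓝 (g x))) : TendstoUniformlyOn f g l s := by
  have heq := (LipschitzOnWith.uniformEquicontinuousOn f K hf).equicontinuousOn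
  have key := (EquicontinuousOn.tendsto_uniformOnFun_iff_pi' (𝔖 := {s})
    (by simpa using hs) (by simpa using heq) l g).2
    (tendsto_pi_nhds.2 fun x => h x (by simpa using x.2))
  exact UniformOnFun.tendsto_iff_tendstoUniformlyOn.1 key s rfl

variable {E : Type*} [NormedAddCommGroup E] [NormedSpace ℝ E] [CompleteSpace E]

theorem IsBddSignal.lipschitzOnWith_flow {M : ℝ} {a : ℝ → Mat E}
    (ha : IsBddSignal M a) (t : ℝ) :
    LipschitzOnWith (M * Real.exp (M * t)).toNNReal (flow a) (Set.Icc 0 t) := by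
  have hM := ha.nonneg
  refine LipschitzOnWith.of_dist_le_mul fun u hu s hs => ?_
  have h := ha.flow_spec t
  have hint : ∀ s ∈ Set.Icc 0 t, IntervalIntegrable (fun r => a r * flow a r) volume 0 s :=
    fun s hs => intervalIntegrable_mul_of_norm_le ha.meas ha.norm_le
      (h.1.mono (Set.uIcc_subset_Icc ⟨le_rfl, hs.1.trans hs.2⟩ hs))
  rw [dist_eq_norm, Real.dist_eq, Real.coe_toNNReal _ (by positivity), h.2 u hu, h.2 s hs,
    add_sub_add_left_eq_sub,
    intervalIntegral.integral_interval_sub_left (hint u hu) (hint s hs)]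
  refine intervalIntegral.norm_integral_le_of_norm_le_const fun r hr => ?_
  have hr' : r ∈ Set.Icc 0 t := Set.uIcc_subset_Icc hs hu (Set.uIoc_subset_uIcc hr)
  refine (norm_mul_le _ _).trans (mul_le_mul (ha.norm_le r) ((ha.norm_flow_le hr'.1).trans ?_)
    (norm_nonneg _) hM)
  have := hr'.2
  gcongr

/-- The flow is weak-star continuous on bounded sets of signals. -/
theorem tendsto_flow [FiniteDimensional ℝ E] {ι : Type*} (l : Ultrafilter ι) {a : ι → ℝ → Mat E}
    {A : ℝ → Mat E} {M : ℝ} (ha : ∀ k, IsBddSignal M (a k)) (hA : IsBddSignal M A)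
    (h : ∀ s t, Tendsto (fun k => ∫ r in s..t, a k r) l (𝓝 (∫ r in s..t, A r))) {t : ℝ}
      (ht : 0 ≤ t) :
    Tendsto (fun k => flow (a k) t) l (𝓝 (flow A t)) := by
  have hM := hA.nonneg
  have hex : ∀ s : ℝ, ∃ x, s ∈ Set.Icc 0 t → Tendsto (fun k => flow (a k) s) l (𝓝 x) := fun s => by
    by_cases hs : s ∈ Set.Icc 0 t
    · obtain ⟨x, -, hx⟩ := exists_tendsto_of_norm_le l (fun k => (ha k).norm_flow_le hs.1)
      exact ⟨x, fun _ => hx⟩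
    · exact ⟨0, fun h => absurd h hs⟩
  choose Ψ hΨ using hex
  have hLip : LipschitzOnWith (M * Real.exp (M * t)).toNNReal Ψ (Set.Icc 0 t) :=
    LipschitzOnWith.of_dist_le_mul fun u hu s hs =>
      le_of_tendsto ((hΨ u hu).dist (hΨ s hs))
        (.of_forall fun k => ((ha k).lipschitzOnWith_flow t).dist_le_mul u hu s hs)
  have hunif : TendstoUniformlyOn (fun k => flow (a k)) Ψ l (Set.Icc 0 t) :=
    tendstoUniformlyOn_of_lipschitzOnWith isCompact_Icc
      (fun k => (ha k).lipschitzOnWith_flow t) hΨ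
  have hfund : IsFundamentalSolution A t Ψ := by
    refine ⟨hLip.continuousOn, fun τ hτ => ?_⟩
    have hsub : Set.uIcc 0 τ ⊆ Set.Icc 0 t := Set.uIcc_subset_Icc ⟨le_rfl, ht⟩ hτ
    have hweak : Tendsto (fun k => ∫ r in (0 : ℝ)..τ, a k r * Ψ r) l
        (𝓝 (∫ r in (0 : ℝ)..τ, A r * Ψ r)) :=
      tendsto_intervalIntegral_mul hM (fun k => (ha k).meas) (fun k => (ha k).norm_le) hA.meas
        hA.norm_le h hτ.1 (hLip.continuousOn.mono (Set.Icc_subset_Icc le_rfl hτ.2))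
    -- Weak times strong: `a k` converges only weakly, but the flows converge uniformly, so
    -- replacing `flow (a k)` by its limit costs nothing.
    have hsmall : Tendsto (fun k => ∫ r in (0 : ℝ)..τ, a k r * (flow (a k) r - Ψ r)) l (𝓝 0) := by
      refine Metric.tendsto_nhds.2 fun ε hε => ?_
      filter_upwards [Metric.tendstoUniformlyOn_iff.1 hunif (ε / ((M + 1) * (t + 1)))
        (by positivity)] with k hk
      rw [dist_zero_right]
      have hb : ‖∫ r in (0 : ℝ)..τ, a k r * (flow (a k) r - Ψ r)‖
          ≤ (M * (ε / ((M + 1) * (t + 1)))) * |τ - 0| := by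
        refine intervalIntegral.norm_integral_le_of_norm_le_const fun r hr => ?_
        have hr' := hsub (Set.uIoc_subset_uIcc hr)
        refine (norm_mul_le _ _).trans (mul_le_mul ((ha k).norm_le r) ?_ (norm_nonneg _) hM)
        rw [← dist_eq_norm, dist_comm]
        exact (hk r hr').le
      refine hb.trans_lt ?_
      rw [sub_zero, abs_of_nonneg hτ.1]
      have h1 : M * (ε / ((M + 1) * (t + 1))) * τ ≤ M * (ε / ((M + 1) * (t + 1))) * t := by
        have := hτ.2
        gcongr
      refine h1.trans_lt ?_
      rw [mul_div_assoc', div_mul_eq_mul_div, div_lt_iff₀ (by positivity)]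
      nlinarith [mul_nonneg hM ht, mul_nonneg hε.le hM, mul_nonneg hε.le ht]
    have hlim := (hweak.add hsmall).const_add (1 : Mat E)
    rw [add_zero] at hlim
    refine tendsto_nhds_unique (hΨ τ hτ) (hlim.congr fun k => ?_)
    have hs := (ha k).flow_spec t
    rw [hs.2 τ hτ]
    simp_rw [mul_sub]
    rw [intervalIntegral.integral_sub
      (intervalIntegrable_mul_of_norm_le (ha k).meas (ha k).norm_le (hs.1.mono hsub))
      (intervalIntegrable_mul_of_norm_le (ha k).meas (ha k).norm_le (hLip.continuousOn.mono hsub)),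
      add_sub_cancel]
  rw [hA.flow_eq hfund ⟨ht, le_rfl⟩]
  exact hΨ t ⟨ht, le_rfl⟩

end

/-! ### Bounds on the growth rate `mu` -/

section

variable {E : Type*} [NormedAddCommGroup E] [NormedSpace ℝ E]
  {F : (t : ℝ≥0) → Set (FinSignal E t)}

section Growth

theorem sSup_rpow_PhiAt_nonneg (t : ℝ≥0) :
    0 ≤ sSup ((fun R : Mat E => ‖R‖ ^ (1 / (t : ℝ))) '' PhiAt F t) :=
  Real.sSup_nonneg (by rintro _ ⟨R, _, rfl⟩; positivity)

theorem isCoboundedUnder_sSup_rpow_PhiAt : IsCoboundedUnder (· ≤ ·) atTop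
    (fun t : ℝ≥0 => sSup ((fun R : Mat E => ‖R‖ ^ (1 / (t : ℝ))) '' PhiAt F t)) :=
  isCoboundedUnder_le_of_le atTop (x := 0) fun t => sSup_rpow_PhiAt_nonneg t

variable {M : ℝ}

theorem rpow_norm_le_exp (hM : ∀ t : ℝ≥0, ∀ R ∈ PhiAt F t, ‖R‖ ≤ Real.exp (M * t)) {t : ℝ≥0}
    (ht : 0 < t) {R : Mat E} (hR : R ∈ PhiAt F t) : ‖R‖ ^ (1 / (t : ℝ)) ≤ Real.exp M := by
  have ht' : (0 : ℝ) < t := ht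
  calc ‖R‖ ^ (1 / (t : ℝ)) ≤ Real.exp (M * t) ^ (1 / (t : ℝ)) :=
        Real.rpow_le_rpow (norm_nonneg _) (hM t R hR) (by positivity)
    _ = Real.exp M := by
        rw [← Real.exp_mul]
        congr 1
        field_simp

theorem isBoundedUnder_sSup_rpow_PhiAt
    (hM : ∀ t : ℝ≥0, ∀ R ∈ PhiAt F t, ‖R‖ ≤ Real.exp (M * t)) :
    IsBoundedUnder (· ≤ ·) atTop
      (fun t : ℝ≥0 => sSup ((fun R : Mat E => ‖R‖ ^ (1 / (t : ℝ))) '' PhiAt F t)) := by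
  refine ⟨Real.exp M, ?_⟩
  rw [eventually_map]
  filter_upwards [eventually_gt_atTop 0] with t ht
  refine Real.sSup_le ?_ (Real.exp_nonneg _)
  rintro _ ⟨R, hR, rfl⟩
  exact rpow_norm_le_exp hM ht hR

/-- A lower bound of the growth rate from products of arbitrarily large length. -/
theorem le_mu_of_frequently (hM : ∀ t : ℝ≥0, ∀ R ∈ PhiAt F t, ‖R‖ ≤ Real.exp (M * t)) {c : ℝ}
    (hc : 0 ≤ c) (h : ∀ t₀ : ℝ≥0, ∃ t, t₀ ≤ t ∧ ∃ R ∈ PhiAt F t, c ^ (t : ℝ) ≤ ‖R‖) :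
    c ≤ mu F := by
  refine le_limsup_of_frequently_le ?_ (isBoundedUnder_sSup_rpow_PhiAt hM)
  refine frequently_atTop.2 fun t₀ => ?_
  -- Asking for `t₀ + 1` ensures `t > 0`, so that `1 / t` inverts the exponent.
  obtain ⟨t, ht, R, hR, hcR⟩ := h (t₀ + 1)
  have ht0 : 0 < t := lt_of_lt_of_le (by positivity) ht
  have ht' : (0 : ℝ) < t := ht0
  refine ⟨t, le_self_add.trans ht, ?_⟩
  have h1 : c ≤ ‖R‖ ^ (1 / (t : ℝ)) := by
    calc c = (c ^ (t : ℝ)) ^ (1 / (t : ℝ)) := by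
          rw [← Real.rpow_mul hc, mul_one_div_cancel ht'.ne', Real.rpow_one]
      _ ≤ _ := Real.rpow_le_rpow (by positivity) hcR (by positivity)
  refine h1.trans (le_csSup ⟨Real.exp M, ?_⟩ ⟨R, hR, rfl⟩)
  rintro _ ⟨R', hR', rfl⟩
  exact rpow_norm_le_exp hM ht0 hR'

/-- The constant disappears in the limit because `C ^ (1 / t) → 1`. -/
theorem mu_le_of_norm_le {c C : ℝ} (hc : 0 < c) (hC : 0 < C)
    (h : ∀ t : ℝ≥0, 0 < t → ∀ R ∈ PhiAt F t, ‖R‖ ≤ C * c ^ (t : ℝ)) : mu F ≤ c := by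
  have hlim : Tendsto (fun t : ℝ≥0 => C ^ (1 / (t : ℝ)) * c) atTop (𝓝 c) := by
    have h1 : Tendsto (fun t : ℝ≥0 => 1 / (t : ℝ)) atTop (𝓝 0) :=
      tendsto_const_nhds.div_atTop (NNReal.tendsto_coe_atTop.2 tendsto_id)
    have h2 := (Real.continuousAt_const_rpow hC.ne' (b := 0)).tendsto.comp h1
    simpa using h2.mul_const c
  rw [← hlim.limsup_eq]
  refine limsup_le_limsup ?_ isCoboundedUnder_sSup_rpow_PhiAt hlim.isBoundedUnder_le
  filter_upwards [eventually_gt_atTop 0] with t ht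
  have ht' : (0 : ℝ) < t := ht
  refine Real.sSup_le ?_ (by positivity)
  rintro _ ⟨R, hR, rfl⟩
  calc ‖R‖ ^ (1 / (t : ℝ)) ≤ (C * c ^ (t : ℝ)) ^ (1 / (t : ℝ)) :=
        Real.rpow_le_rpow (norm_nonneg _) (h t ht R hR) (by positivity)
    _ = C ^ (1 / (t : ℝ)) * c := by
        rw [Real.mul_rpow hC.le (by positivity), ← Real.rpow_mul hc.le,
          mul_one_div_cancel ht'.ne', Real.rpow_one]

end Growth

/-! ### From irreducibility to quasi-extremality -/

section QuasiExtremal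

/-- If every nonzero vector can be expanded by a factor `2` relatively to the growth `μ^t` in time
at most `T`, then it can be expanded by `2 ^ N` in time at most `N T`. -/
theorem exists_pow_two_mul_le
    (hmul : ∀ s t : ℝ≥0, ∀ R ∈ PhiAt F s, ∀ T ∈ PhiAt F t, T * R ∈ PhiAt F (s + t)) {μ : ℝ}
    (hμ : 0 < μ) {T : ℝ}
    (h : ∀ x : E, x ≠ 0 → ∃ t : ℝ≥0, (t : ℝ) ≤ T ∧
      ∃ R ∈ PhiAt F t, 2 * μ ^ (t : ℝ) * ‖x‖ ≤ ‖R x‖) (N : ℕ) {x : E} (hx : x ≠ 0) :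
    ∃ t : ℝ≥0, (t : ℝ) ≤ (N + 1) * T ∧
      ∃ R ∈ PhiAt F t, 2 ^ (N + 1) * μ ^ (t : ℝ) * ‖x‖ ≤ ‖R x‖ := by
  induction N with
  -- The induction starts with one factor: `F 0` may be empty, so the identity need not be
  -- available.
  | zero => simpa using h x hx
  | succ N ih =>
    obtain ⟨s, hs, R, hR, hRx⟩ := ih
    have hpos : 0 < ‖x‖ := norm_pos_iff.2 hx
    have hRx0 : R x ≠ 0 := norm_pos_iff.1 (lt_of_lt_of_le (by positivity) hRx)
    obtain ⟨t, ht, T', hT', hTx⟩ := h (R x) hRx0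
    refine ⟨s + t, by push_cast; linarith, T' * R, hmul s t R hR T' hT', ?_⟩
    refine le_trans ?_ hTx
    calc 2 ^ (N + 1 + 1) * μ ^ ((s + t : ℝ≥0) : ℝ) * ‖x‖
        = 2 * μ ^ (t : ℝ) * (2 ^ (N + 1) * μ ^ (s : ℝ) * ‖x‖) := by
          rw [NNReal.coe_add, Real.rpow_add hμ]; ring
      _ ≤ _ := by gcongr

theorem quasiExtremal_of_irreducible [FiniteDimensional ℝ E] [Nontrivial E] {M : ℝ}
    (hmul : ∀ s t : ℝ≥0, ∀ R ∈ PhiAt F s, ∀ T ∈ PhiAt F t, T * R ∈ PhiAt F (s + t))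
    (hM : ∀ t : ℝ≥0, ∀ R ∈ PhiAt F t, ‖R‖ ≤ Real.exp (M * t))
    (hμ : 0 < mu F) (hirr : IsIrreducible (Phi F)) : QuasiExtremal F := by
  have : CompleteSpace E := FiniteDimensional.complete ℝ E
  have : ProperSpace E := FiniteDimensional.proper ℝ E
  -- Vectors with orbit `O(μ^t)`, the constant depending on the vector.
  let V : Submodule ℝ E :=
    { carrier := {x | ∃ C : ℝ, ∀ t : ℝ≥0, ∀ R ∈ PhiAt F t, ‖R x‖ ≤ C * mu F ^ (t : ℝ)}
      add_mem' := by
        rintro x y ⟨C, hC⟩ ⟨D, hD⟩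
        refine ⟨C + D, fun t R hR => ?_⟩
        rw [map_add, add_mul]
        exact (norm_add_le _ _).trans (add_le_add (hC t R hR) (hD t R hR))
      zero_mem' := ⟨0, by simp⟩
      smul_mem' := by
        rintro c x ⟨C, hC⟩
        refine ⟨‖c‖ * C, fun t R hR => ?_⟩
        rw [map_smul, norm_smul, mul_assoc]
        exact mul_le_mul_of_nonneg_left (hC t R hR) (norm_nonneg _) }
  have hV : ∀ R ∈ Phi F, ∀ x ∈ V, R x ∈ V := by
    rintro R hR x ⟨C, hC⟩
    obtain ⟨s, hs⟩ := Set.mem_iUnion.1 hR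
    refine ⟨C * mu F ^ (s : ℝ), fun t T hT => ?_⟩
    rw [mul_assoc, ← Real.rpow_add hμ]
    exact hC (s + t) (T * R) (hmul s t R hs T hT)
  rcases hirr V hV with hbot | htop
  · exfalso
    have hex : ∀ x : E, x ≠ 0 → ∃ t : ℝ≥0, ∃ R ∈ PhiAt F t, 2 * mu F ^ (t : ℝ) < ‖R x‖ := by
      intro x hx
      by_contra hcon
      push Not at hcon
      have : x ∈ V := ⟨2, hcon⟩
      rw [hbot, Submodule.mem_bot] at this
      exact hx this
    obtain ⟨b, hb⟩ := (isCompact_sphere (0 : E) 1).elim_finite_subcover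
      (fun p : (Σ t : ℝ≥0, PhiAt F t) => {x | 2 * mu F ^ (p.1 : ℝ) < ‖(p.2 : Mat E) x‖})
      (fun p => isOpen_lt continuous_const (by fun_prop))
      (fun x hx => by
        have hx0 : x ≠ 0 := ne_zero_of_mem_unit_sphere (⟨x, hx⟩ : Metric.sphere (0 : E) 1)
        obtain ⟨t, R, hR, hlt⟩ := hex x hx0
        exact Set.mem_iUnion.2 ⟨⟨t, R, hR⟩, hlt⟩)
    -- The sum dominates every time in the finite subcover; the `1` makes `T` positive.
    set T : ℝ := ∑ p ∈ b, (p.1 : ℝ) + 1 with hT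
    have hT0 : 0 < T := by positivity
    have hstep : ∀ x : E, x ≠ 0 → ∃ t : ℝ≥0, (t : ℝ) ≤ T ∧
        ∃ R ∈ PhiAt F t, 2 * mu F ^ (t : ℝ) * ‖x‖ ≤ ‖R x‖ := by
      intro x hx
      have hn : 0 < ‖x‖ := norm_pos_iff.2 hx
      have hmem : ‖x‖⁻¹ • x ∈ Metric.sphere (0 : E) 1 := by
        simp [norm_smul, hn.ne']
      obtain ⟨p, hp, hlt⟩ := Set.mem_iUnion₂.1 (hb hmem)
      refine ⟨p.1, ?_, p.2, p.2.2, ?_⟩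
      · have := Finset.single_le_sum (f := fun p : (Σ t : ℝ≥0, PhiAt F t) => (p.1 : ℝ))
          (fun _ _ => NNReal.coe_nonneg _) hp
        beta_reduce at this
        linarith
      · have hlt' : 2 * mu F ^ (p.1 : ℝ) < ‖x‖⁻¹ * ‖(p.2 : Mat E) x‖ := by
          simpa [norm_smul] using hlt
        rw [inv_mul_eq_div, lt_div_iff₀ hn] at hlt'
        exact hlt'.le
    obtain ⟨x, hx⟩ := exists_ne (0 : E)
    have hn : 0 < ‖x‖ := norm_pos_iff.2 hx
    have hM0 : ∀ t : ℝ≥0, ∀ R ∈ PhiAt F t, ‖R‖ ≤ Real.exp (|M| * t) := fun t R hR =>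
      (hM t R hR).trans (Real.exp_le_exp.2
        (mul_le_mul_of_nonneg_right (le_abs_self M) t.coe_nonneg))
    -- Doubling once per time `T` multiplies the growth rate by `2 ^ (1 / T) > 1`, which is absurd.
    have hle : (2 : ℝ) ^ (1 / T) * mu F ≤ mu F := by
      refine le_mu_of_frequently hM (by positivity) fun t₀ => ?_
      -- In time at most `t₀` the expansion relative to `μ^t` is bounded by the displayed quantity,
      -- so this `N` forces the product to last longer than `t₀`.
      obtain ⟨N, hN⟩ := pow_unbounded_of_one_lt
        (Real.exp (|M| * t₀) * (max 1 (mu F)⁻¹) ^ (t₀ : ℝ)) (one_lt_two (α := ℝ))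
      obtain ⟨t, ht, R, hR, hRx⟩ := exists_pow_two_mul_le hmul hμ hstep N hx
      have hRn : 2 ^ (N + 1) * mu F ^ (t : ℝ) ≤ ‖R‖ :=
        le_of_mul_le_mul_right (hRx.trans (R.le_opNorm x)) hn
      refine ⟨t, ?_, R, hR, ?_⟩
      · by_contra hlt
        have hlt' : (t : ℝ) ≤ t₀ := (not_le.1 hlt).le
        have h1 : (2 : ℝ) ^ (N + 1) * mu F ^ (t : ℝ) ≤ Real.exp (|M| * t) :=
          hRn.trans (hM0 t R hR)
        have h2 : (2 : ℝ) ^ (N + 1) ≤ Real.exp (|M| * t) * ((mu F)⁻¹) ^ (t : ℝ) := by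
          rw [Real.inv_rpow hμ.le, ← div_eq_mul_inv, le_div_iff₀ (by positivity)]
          exact h1
        have h3 : Real.exp (|M| * t) * ((mu F)⁻¹) ^ (t : ℝ)
            ≤ Real.exp (|M| * t₀) * (max 1 (mu F)⁻¹) ^ (t₀ : ℝ) := by
          refine mul_le_mul (by gcongr) ?_ (by positivity) (by positivity)
          exact (Real.rpow_le_rpow (by positivity) (le_max_right _ _) t.coe_nonneg).trans
            (Real.rpow_le_rpow_of_exponent_le (le_max_left _ _) hlt')
        have h4 : (2 : ℝ) ^ N ≤ 2 ^ (N + 1) := by gcongr <;> norm_num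
        linarith
      · refine le_trans ?_ hRn
        rw [Real.mul_rpow (by positivity) hμ.le, ← Real.rpow_mul (by norm_num)]
        refine mul_le_mul_of_nonneg_right ?_ (by positivity)
        rw [← Real.rpow_natCast]
        refine Real.rpow_le_rpow_of_exponent_le one_le_two ?_
        rw [one_div_mul_eq_div, div_le_iff₀ hT0]
        exact_mod_cast ht
    have h2 : 1 < (2 : ℝ) ^ (1 / T) := Real.one_lt_rpow one_lt_two (by positivity)
    nlinarith
  · have hpt : ∀ x : E, ∃ C, ∀ p : (Σ t : ℝ≥0, PhiAt F t),
        ‖(mu F ^ (-(p.1 : ℝ)) • (p.2 : Mat E)) x‖ ≤ C := by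
      intro x
      obtain ⟨C, hC⟩ : x ∈ V := by rw [htop]; trivial
      refine ⟨C, fun p => ?_⟩
      have := hC p.1 p.2 p.2.2
      rw [smul_apply, norm_smul, Real.norm_of_nonneg (by positivity),
        Real.rpow_neg hμ.le, inv_mul_eq_div, div_le_iff₀ (by positivity)]
      exact this
    obtain ⟨C, hC⟩ := banach_steinhaus hpt
    refine ⟨max C 1, by positivity, fun t R hR => ?_⟩
    have := hC ⟨t, R, hR⟩
    rw [norm_smul, Real.norm_of_nonneg (by positivity), Real.rpow_neg hμ.le, inv_mul_eq_div,
      div_le_iff₀ (by positivity)] at this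
    exact this.trans (mul_le_mul_of_nonneg_right (le_max_left _ _) (by positivity))

end QuasiExtremal

end

/-! ### The limit set and its extremal norm -/

section

variable {E : Type*} [NormedAddCommGroup E] [NormedSpace ℝ E]
  {F : (t : ℝ≥0) → Set (FinSignal E t)}

theorem IsNorm.exists_pos_mul_norm_le [FiniteDimensional ℝ E] {w : E → ℝ} (hw : IsNorm w) {B : ℝ}
    (hB : ∀ x, w x ≤ B * ‖x‖) : ∃ c, 0 < c ∧ ∀ x, c * ‖x‖ ≤ w x := by
  have : ProperSpace E := FiniteDimensional.proper ℝ E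
  have hneg : ∀ x, w (-x) = w x := fun x => by simpa using hw.smul (-1) x
  have hcont : Continuous w := by
    refine (LipschitzWith.of_dist_le_mul (K := B.toNNReal) fun x y => ?_).continuous
    have hxy : w (x - y) ≤ B.toNNReal * dist x y := by
      rw [dist_eq_norm]
      exact (hB _).trans (mul_le_mul_of_nonneg_right (Real.le_coe_toNNReal B) (norm_nonneg _))
    have h1 := hw.add_le (x - y) y
    have h2 := hw.add_le (y - x) x
    rw [sub_add_cancel] at h1 h2
    rw [← neg_sub x y, hneg] at h2
    rw [Real.dist_eq, abs_le]
    constructor <;> linarith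
  rcases subsingleton_or_nontrivial E with hE | hE
  · exact ⟨1, one_pos, fun x => by
      rw [Subsingleton.elim x 0, norm_zero, mul_zero]; exact hw.nonneg 0⟩
  · have hne : (Metric.sphere (0 : E) 1).Nonempty := NormedSpace.sphere_nonempty.2 zero_le_one
    obtain ⟨y, hy, hmin⟩ := (isCompact_sphere (0 : E) 1).exists_isMinOn hne hcont.continuousOn
    have hy0 : y ≠ 0 := ne_zero_of_mem_unit_sphere (⟨y, hy⟩ : Metric.sphere (0 : E) 1)
    refine ⟨w y, lt_of_le_of_ne (hw.nonneg y) fun h => hy0 (hw.eq_zero y h.symm), fun x => ?_⟩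
    rcases eq_or_ne x 0 with rfl | hx
    · simpa using hw.nonneg 0
    · have hn : 0 < ‖x‖ := norm_pos_iff.2 hx
      have hmem : ‖x‖⁻¹ • x ∈ Metric.sphere (0 : E) 1 := by simp [norm_smul, hn.ne']
      have h := isMinOn_iff.1 hmin _ hmem
      rw [hw.smul, abs_of_nonneg (by positivity), inv_mul_eq_div, le_div_iff₀ hn] at h
      exact h

/-- The properties of the semigroup `Φ(F)` on which the structure of its limit set depends. -/
structure IsRegularSemigroup (F : (t : ℝ≥0) → Set (FinSignal E t)) : Prop where
  mul_mem : ∀ s t : ℝ≥0, ∀ R ∈ PhiAt F s, ∀ T ∈ PhiAt F t, T * R ∈ PhiAt F (s + t)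
  mu_pos : 0 < mu F
  irreducible : IsIrreducible (Phi F)
  quasiExtremal : QuasiExtremal F
  not_small : ∃ ε : ℝ, 0 < ε ∧ ∀ t₀ : ℝ≥0, ∃ t, t₀ ≤ t ∧ ∃ R ∈ PhiAt F t,
    ε * mu F ^ (t : ℝ) ≤ ‖R‖

/-- Membership as an approximation property, which spares a diagonal extraction when proving
closedness. -/
theorem mem_Rinfty_iff {R : Mat E} : R ∈ Rinfty F ↔ ∀ ε > 0, ∀ t₀ : ℝ≥0, ∃ t, t₀ ≤ t ∧
    ∃ T ∈ PhiAt F t, dist (mu F ^ (-(t : ℝ)) • T) R < ε := by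
  constructor
  · rintro ⟨t, r, ht, hr, hlim⟩ ε hε t₀
    obtain ⟨k, hk, hk'⟩ :=
      ((ht.eventually_ge_atTop t₀).and (Metric.tendsto_nhds.1 hlim ε hε)).exists
    exact ⟨t k, hk, r k, hr k, hk'⟩
  · intro h
    choose t ht r hr hd using fun k : ℕ => h (1 / ((k : ℝ) + 1)) Nat.one_div_pos_of_nat k
    refine ⟨t, r, tendsto_atTop_mono ht tendsto_natCast_atTop_atTop, hr, ?_⟩
    exact tendsto_iff_dist_tendsto_zero.2 (squeeze_zero (fun _ => dist_nonneg)
      (fun k => (hd k).le) tendsto_one_div_add_atTop_nhds_zero_nat)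

theorem isClosed_Rinfty : IsClosed (Rinfty F) := by
  refine isClosed_of_closure_subset fun R hR => mem_Rinfty_iff.2 fun ε hε t₀ => ?_
  obtain ⟨Q, hQ, hRQ⟩ := Metric.mem_closure_iff.1 hR (ε / 2) (by positivity)
  obtain ⟨t, ht, T, hT, hd⟩ := mem_Rinfty_iff.1 hQ (ε / 2) (by positivity) t₀
  refine ⟨t, ht, T, hT, (dist_triangle _ Q _).trans_lt ?_⟩
  rw [dist_comm] at hRQ
  linarith

theorem IsNorm.of_isGreatest {𝓡 : Set (Mat E)} {w : E → ℝ}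
    (hw : ∀ x, IsGreatest ((fun R : Mat E => ‖R x‖) '' 𝓡) (w x))
    (h0 : ∀ x : E, (∀ R ∈ 𝓡, R x = 0) → x = 0) : IsNorm w where
  nonneg x := by
    obtain ⟨R, _, hR⟩ := (hw x).1
    rw [← hR]; positivity
  eq_zero x hx := h0 x fun R hR => by
    have := (hw x).2 ⟨R, hR, rfl⟩
    rw [hx] at this
    exact norm_le_zero_iff.1 this
  add_le x y := by
    obtain ⟨R, hR, hRxy⟩ := (hw (x + y)).1
    rw [← hRxy]
    beta_reduce
    rw [map_add]
    exact (norm_add_le _ _).trans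
      (add_le_add ((hw x).2 ⟨R, hR, rfl⟩) ((hw y).2 ⟨R, hR, rfl⟩))
  smul c x := by
    refine (hw (c • x)).unique ⟨?_, ?_⟩
    · obtain ⟨R, hR, hRx⟩ := (hw x).1
      exact ⟨R, hR, by simp [norm_smul, ← hRx]⟩
    · rintro _ ⟨R, hR, rfl⟩
      beta_reduce
      rw [map_smul, norm_smul, Real.norm_eq_abs]
      exact mul_le_mul_of_nonneg_left ((hw x).2 ⟨R, hR, rfl⟩) (abs_nonneg c)

namespace IsRegularSemigroup

theorem exists_norm_smul_le (h : IsRegularSemigroup F) : ∃ C : ℝ, 0 < C ∧ ∀ t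
    : ℝ≥0, ∀ R ∈ PhiAt F t,
    ‖mu F ^ (-(t : ℝ)) • R‖ ≤ C := by
  have hμ := h.mu_pos
  obtain ⟨C, hC, hCR⟩ := h.quasiExtremal
  refine ⟨C, hC, fun t R hR => ?_⟩
  rw [norm_smul, Real.norm_of_nonneg (by positivity), Real.rpow_neg hμ.le, inv_mul_eq_div,
    div_le_iff₀ (by positivity)]
  exact hCR t R hR

theorem isBounded_Rinfty (h : IsRegularSemigroup F) : Bornology.IsBounded (Rinfty F) := by
  obtain ⟨C, _, hC⟩ := h.exists_norm_smul_le
  refine isBounded_iff_forall_norm_le.2 ⟨C, ?_⟩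
  rintro R ⟨t, r, _, hr, hlim⟩
  exact le_of_tendsto hlim.norm (.of_forall fun k => hC _ _ (hr k))

theorem isCompact_Rinfty (h : IsRegularSemigroup F) [FiniteDimensional ℝ E] : IsCompact
    (Rinfty F) := by
  have : ProperSpace (Mat E) := FiniteDimensional.proper ℝ _
  exact Metric.isCompact_of_isClosed_isBounded isClosed_Rinfty h.isBounded_Rinfty

/-- `not_small` supplies arbitrarily long rescaled products of norm at least `ε`, quasi-extremality
bounds them, and a subsequence converges. -/
theorem exists_ne_zero_mem_Rinfty (h : IsRegularSemigroup F) [FiniteDimensional ℝ E]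
    : ∃ R ∈ Rinfty F, R ≠ 0 := by
  have hμ := h.mu_pos
  have : ProperSpace (Mat E) := FiniteDimensional.proper ℝ _
  obtain ⟨ε, hε, hε'⟩ := h.not_small
  obtain ⟨C, _, hC⟩ := h.exists_norm_smul_le
  choose t ht r hr hεr using fun k : ℕ => hε' k
  have htt : Tendsto t atTop atTop := tendsto_atTop_mono ht tendsto_natCast_atTop_atTop
  obtain ⟨R, _, φ, hφ, hlim⟩ := (isCompact_closedBall (0 : Mat E) C).tendsto_subseq
    (x := fun k => mu F ^ (-(t k : ℝ)) • r k)
    (fun k => by simpa using hC _ _ (hr k))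
  refine ⟨R, ⟨t ∘ φ, r ∘ φ, htt.comp hφ.tendsto_atTop, fun k => hr _, hlim⟩, ?_⟩
  have : ε ≤ ‖R‖ := by
    refine ge_of_tendsto hlim.norm (.of_forall fun k => ?_)
    simp only [Function.comp_apply]
    rw [norm_smul, Real.norm_of_nonneg (by positivity), Real.rpow_neg hμ.le, inv_mul_eq_div,
      le_div_iff₀ (by positivity)]
    exact hεr (φ k)
  exact norm_pos_iff.1 (hε.trans_le this)

theorem nonempty_Rinfty (h : IsRegularSemigroup F) [FiniteDimensional ℝ E] : (Rinfty F).Nonempty :=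
  let ⟨R, hR, _⟩ := h.exists_ne_zero_mem_Rinfty
  ⟨R, hR⟩

theorem Rinfty_ne_singleton_zero (h : IsRegularSemigroup F) [FiniteDimensional ℝ E] : Rinfty F ≠
    {0} := fun heq => by
  obtain ⟨R, hR, hR0⟩ := h.exists_ne_zero_mem_Rinfty
  rw [heq] at hR
  exact hR0 hR

theorem smul_mul_smul (h : IsRegularSemigroup F) (s t : ℝ≥0) (R T : Mat E) :
    (mu F ^ (-(s : ℝ)) • R) * (mu F ^ (-(t : ℝ)) • T)
      = mu F ^ (-((s + t : ℝ≥0) : ℝ)) • (R * T) := by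
  rw [smul_mul_smul_comm, ← Real.rpow_add h.mu_pos]
  congr 2
  push_cast
  ring

theorem mul_mem_Rinfty (h : IsRegularSemigroup F) {P Q : Mat E} (hP : P ∈ Rinfty F)
    (hQ : Q ∈ Rinfty F) :
    P * Q ∈ Rinfty F := by
  obtain ⟨s, p, hs, hp, hpl⟩ := hP
  obtain ⟨t, q, ht, hq, hql⟩ := hQ
  refine ⟨fun k => t k + s k, fun k => p k * q k, tendsto_atTop_mono (fun k => le_self_add) ht,
    fun k => h.mul_mem _ _ _ (hq k) _ (hp k), ?_⟩
  refine (hpl.mul hql).congr fun k => ?_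
  rw [h.smul_mul_smul, add_comm]

theorem smul_mul_mem_Rinfty (h : IsRegularSemigroup F) {t : ℝ≥0} {T Q : Mat E}
    (hT : T ∈ PhiAt F t) (hQ : Q ∈ Rinfty F) :
    mu F ^ (-(t : ℝ)) • (T * Q) ∈ Rinfty F := by
  obtain ⟨s, q, hs, hq, hql⟩ := hQ
  refine ⟨fun k => s k + t, fun k => T * q k, tendsto_atTop_mono (fun k => le_self_add) hs,
    fun k => h.mul_mem _ _ _ (hq k) _ hT, ?_⟩
  have := hql.const_mul (mu F ^ (-(t : ℝ)) • T)
  rw [smul_mul_assoc] at this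
  refine this.congr fun k => ?_
  rw [h.smul_mul_smul, add_comm]

theorem smul_mul_mem_Rinfty' (h : IsRegularSemigroup F) {t : ℝ≥0} {T Q : Mat E}
    (hT : T ∈ PhiAt F t) (hQ : Q ∈ Rinfty F) :
    mu F ^ (-(t : ℝ)) • (Q * T) ∈ Rinfty F := by
  obtain ⟨s, q, hs, hq, hql⟩ := hQ
  refine ⟨fun k => t + s k, fun k => q k * T, tendsto_atTop_mono (fun k => le_add_self) hs,
    fun k => h.mul_mem _ _ _ hT _ (hq k), ?_⟩
  have := hql.mul_const (mu F ^ (-(t : ℝ)) • T)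
  rw [mul_smul_comm] at this
  refine this.congr fun k => ?_
  rw [h.smul_mul_smul, add_comm]

/-- The common kernel of the limit set is trivial. -/
theorem eq_zero_of_forall_Rinfty (h : IsRegularSemigroup F) [FiniteDimensional ℝ E] {x : E}
    (hx : ∀ R ∈ Rinfty F, R x = 0) : x = 0 := by
  have hμ := h.mu_pos
  -- The common kernel is invariant because the limit set is stable under rescaled right
  -- multiplication by `Φ(F)`; it is not the whole space because some limit is nonzero.
  let K : Submodule ℝ E :=
    { carrier := {x | ∀ R ∈ Rinfty F, R x = 0}
      add_mem' := fun {x y} hx hy R hR => by rw [map_add, hx R hR, hy R hR, add_zero]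
      zero_mem' := fun R _ => map_zero R
      smul_mem' := fun c x hx R hR => by rw [map_smul, hx R hR, smul_zero] }
  have hK : ∀ T ∈ Phi F, ∀ x ∈ K, T x ∈ K := by
    rintro T hT x hx Q hQ
    obtain ⟨t, ht⟩ := Set.mem_iUnion.1 hT
    have := hx _ (h.smul_mul_mem_Rinfty' ht hQ)
    exact (smul_eq_zero.1 this).resolve_left (by positivity)
  rcases h.irreducible K hK with hbot | htop
  · have : x ∈ K := hx
    rwa [hbot, Submodule.mem_bot] at this
  · obtain ⟨R, hR, hR0⟩ := h.exists_ne_zero_mem_Rinfty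
    refine absurd (ContinuousLinearMap.ext fun y => ?_) hR0
    have : y ∈ K := by rw [htop]; trivial
    exact this R hR

/-- For `V` invariant under the limit set, the span `W ⊆ V` of the images of `V` is invariant under
`Φ(F)`. If `W = ⊥`, then `V` lies in the common kernel; if `W = ⊤`, then `V = ⊤`. -/
theorem isIrreducible_Rinfty (h : IsRegularSemigroup F) [FiniteDimensional ℝ E] : IsIrreducible
    (Rinfty F) := by
  have hμ := h.mu_pos
  intro V hV
  let W : Submodule ℝ E := Submodule.span ℝ {y | ∃ Q ∈ Rinfty F, ∃ x ∈ V, y = Q x}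
  have hWV : W ≤ V := Submodule.span_le.2 (by
    rintro _ ⟨Q, hQ, x, hx, rfl⟩
    exact hV Q hQ x hx)
  have hW : ∀ T ∈ Phi F, ∀ x ∈ W, T x ∈ W := by
    intro T hT
    obtain ⟨t, ht⟩ := Set.mem_iUnion.1 hT
    suffices W ≤ W.comap (T : E →ₗ[ℝ] E) from fun x hx => this hx
    refine Submodule.span_le.2 ?_
    rintro _ ⟨Q, hQ, x, hx, rfl⟩
    have hmem : (mu F ^ (-(t : ℝ)) • (T * Q)) x ∈ W :=
      Submodule.subset_span ⟨_, h.smul_mul_mem_Rinfty ht hQ, x, hx, rfl⟩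
    have hne : mu F ^ (-(t : ℝ)) ≠ 0 := by positivity
    exact (W.smul_mem_iff hne).1 hmem
  rcases h.irreducible W hW with hbot | htop
  · left
    refine (Submodule.eq_bot_iff V).2 fun x hx => h.eq_zero_of_forall_Rinfty fun Q hQ => ?_
    have : Q x ∈ W := Submodule.subset_span ⟨Q, hQ, x, hx, rfl⟩
    rwa [hbot, Submodule.mem_bot] at this
  · right
    rw [htop] at hWV
    exact top_le_iff.1 hWV

theorem isGreatest_vhat (h : IsRegularSemigroup F) [FiniteDimensional ℝ E] (x : E) :
    IsGreatest ((fun R : Mat E => ‖R x‖) '' Rinfty F) (vhat F x) :=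
  (h.isCompact_Rinfty.image (by fun_prop)).isGreatest_sSup (h.nonempty_Rinfty.image _)

theorem isNorm_vhat (h : IsRegularSemigroup F) [FiniteDimensional ℝ E] : IsNorm (vhat F) :=
  IsNorm.of_isGreatest h.isGreatest_vhat fun _ hx => h.eq_zero_of_forall_Rinfty hx

/-- If `Q` attains the maximum at `T x`, then `μ^{-t} Q T` competes in the maximum at `x`. -/
theorem isExtremalNorm_vhat (h : IsRegularSemigroup F) [FiniteDimensional ℝ E]
    : IsExtremalNorm F (vhat F) := by
  have hμ := h.mu_pos
  refine ⟨h.isNorm_vhat, fun t T hT => csSup_le ?_ ?_⟩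
  · exact ⟨_, 0, by simpa using (h.isNorm_vhat.smul 0 0).trans_le (by simp), rfl⟩
  · rintro _ ⟨x, hx, rfl⟩
    obtain ⟨Q, hQ, hQx⟩ := (h.isGreatest_vhat (T x)).1
    have h1 := (h.isGreatest_vhat x).2 ⟨_, h.smul_mul_mem_Rinfty' hT hQ, rfl⟩
    beta_reduce at h1 hQx ⊢
    rw [smul_apply, norm_smul, Real.norm_of_nonneg (by positivity), Real.rpow_neg hμ.le,
      inv_mul_eq_div, div_le_iff₀ (by positivity)] at h1
    rw [← hQx]
    exact h1.trans (mul_le_of_le_one_left (by positivity) hx)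

theorem extremal (h : IsRegularSemigroup F) [FiniteDimensional ℝ E] : Extremal F :=
  ⟨h.quasiExtremal, _, h.isExtremalNorm_vhat⟩

theorem quasiBarabanov (h : IsRegularSemigroup F) [FiniteDimensional ℝ E] : QuasiBarabanov F := by
  have hμ := h.mu_pos
  obtain ⟨B, hB⟩ := isBounded_iff_forall_norm_le.1 h.isBounded_Rinfty
  obtain ⟨c, hc, hcw⟩ := h.isNorm_vhat.exists_pos_mul_norm_le (B := B) fun x => by
    obtain ⟨Q, hQ, hQx⟩ := (h.isGreatest_vhat x).1
    rw [← hQx]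
    exact Q.le_of_opNorm_le (hB Q hQ) x
  refine ⟨h.quasiExtremal, c / 2, by positivity, fun x t => ?_⟩
  rcases eq_or_ne x 0 with rfl | hx
  -- Even for `x = 0` a product of length at least `t` is needed.
  · obtain ⟨ε, _, hε⟩ := h.not_small
    obtain ⟨t', ht', R, hR, _⟩ := hε t
    exact ⟨t', ht', R, hR, by simp⟩
  · have hn : 0 < ‖x‖ := norm_pos_iff.2 hx
    obtain ⟨Q, ⟨s, q, hs, hq, hlim⟩, hQx⟩ := (h.isGreatest_vhat x).1
    -- The maximizer expands `x` by at least `c`; halving leaves room to replace it by an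
    -- approximating product.
    have h1 : c / 2 * ‖x‖ < ‖Q x‖ := by
      have : c * ‖x‖ ≤ ‖Q x‖ := (hcw x).trans_eq hQx.symm
      have := mul_pos hc hn
      linarith
    have h2 : Tendsto (fun k => ‖(mu F ^ (-(s k : ℝ)) • q k) x‖) atTop (𝓝 ‖Q x‖) :=
      ((ContinuousLinearMap.apply ℝ E x).continuous.tendsto Q |>.comp hlim).norm
    obtain ⟨k, hk, hk'⟩ := ((h2.eventually_const_lt h1).and (hs.eventually_ge_atTop t)).exists
    refine ⟨s k, hk', q k, hq k, ?_⟩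
    rw [smul_apply, norm_smul, Real.norm_of_nonneg (by positivity), Real.rpow_neg hμ.le,
      inv_mul_eq_div, lt_div_iff₀ (by positivity)] at hk
    linarith

end IsRegularSemigroup

end

/-! ### Periodic extension of finite signals -/

section

variable {E : Type*} [NormedAddCommGroup E] [NormedSpace ℝ E]

theorem ae_mem_imp_comp_sub_eq {f g : ℝ → Mat E} {u : Set ℝ} (hu : MeasurableSet u)
    (h : f =ᵐ[volume.restrict u] g) (s : ℝ) : ∀ᵐ τ, τ - s ∈ u → f (τ - s) = g (τ - s) :=
  (measurePreserving_sub_right volume s).quasiMeasurePreserving.ae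
    ((ae_restrict_iff' hu).1 h)

theorem concat_ae_eq {A B a b : ℝ → Mat E} {s t : ℝ}
    (hA : A =ᵐ[volume.restrict (Set.Icc 0 s)] a) (hB : B =ᵐ[volume.restrict (Set.Icc 0 t)] b) :
    concat s A B =ᵐ[volume.restrict (Set.Icc 0 (s + t))] concat s a b := by
  rw [EventuallyEq, ae_restrict_iff' measurableSet_Icc]
  filter_upwards [(ae_restrict_iff' measurableSet_Icc).1 hA,
    ae_mem_imp_comp_sub_eq measurableSet_Icc hB s] with τ h1 h2 hτ
  unfold concat
  split_ifs with hs
  · exact h1 ⟨hτ.1, hs⟩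
  · exact h2 ⟨by linarith, by linarith [hτ.2]⟩

theorem flow_congr_Ici {A B : ℝ → Mat E} (h : A =ᵐ[volume.restrict (Set.Ici 0)] B) (t : ℝ) :
    flow A t = flow B t :=
  flow_congr (ae_restrict_of_ae_restrict_of_subset Set.Icc_subset_Ici_self h)

/-- The class in `L_∞([0,∞))` of a bounded signal. -/
noncomputable def IsBddSignal.toInf {M : ℝ} {a : ℝ → Mat E} (ha : IsBddSignal M a) :
    InfSignal E :=
  (memLp_top_of_bound ha.meas.aestronglyMeasurable M (.of_forall ha.norm_le)).toLp a

theorem IsBddSignal.coeFn_toInf {M : ℝ} {a : ℝ → Mat E} (ha : IsBddSignal M a) :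
    ha.toInf =ᵐ[volume.restrict (Set.Ici 0)] a :=
  MemLp.coeFn_toLp _

/-- The periodic extension of a signal on `[0,t]`. -/
noncomputable def periodize (t : ℝ) (a : ℝ → Mat E) (τ : ℝ) : Mat E := a (t * Int.fract (τ / t))

theorem IsBddSignal.periodize {M : ℝ} {a : ℝ → Mat E} (ha : IsBddSignal M a) (t : ℝ) :
    IsBddSignal M (periodize t a) :=
  ⟨ha.meas.comp_measurable ((measurable_fract.comp (measurable_id.div_const t)).const_mul t),
    fun _ => ha.norm_le _⟩

theorem periodize_apply {a : ℝ → Mat E} {t τ : ℝ} (hτ : τ ∈ Set.Ico 0 t) (k : ℕ) :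
    periodize t a (k * t + τ) = a τ := by
  have ht : 0 < t := hτ.1.trans_lt hτ.2
  have h1 : (k * t + τ) / t = τ / t + k := by field_simp; ring
  have h2 : Int.fract (τ / t) = τ / t :=
    Int.fract_eq_self.2 ⟨div_nonneg hτ.1 ht.le, (div_lt_one ht).2 hτ.2⟩
  rw [periodize, h1, Int.fract_add_natCast, h2, mul_div_cancel₀ _ ht.ne']

variable {F : (t : ℝ≥0) → Set (FinSignal E t)} {S : Set (InfSignal E)} {M : ℝ}

theorem toInf_periodize_mem_Finfty {t : ℝ≥0} (ht : 0 < t) {A : FinSignal E t} (hA : A ∈ F t)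
    {a : ℝ → Mat E} (ha : IsBddSignal M a)
    (hAa : A =ᵐ[volume.restrict (Set.Icc 0 (t : ℝ))] a) :
    (ha.periodize t).toInf ∈ Finfty F := by
  refine ⟨fun _ => t, fun _ => A, fun _ => hA, ?_, fun k => ?_⟩
  · simp only [Finset.sum_const, Finset.card_range]
    exact tendsto_id.atTop_nsmul_const ht
  · simp only [Finset.sum_const, Finset.card_range, nsmul_eq_mul]
    have h1 : ∀ᵐ τ : ℝ, k * (t : ℝ) + τ ∈ Set.Ici (0 : ℝ) →
        (ha.periodize t).toInf (k * (t : ℝ) + τ) = periodize t a (k * (t : ℝ) + τ) :=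
      (measurePreserving_add_left volume (k * (t : ℝ))).quasiMeasurePreserving.ae
        ((ae_restrict_iff' measurableSet_Ici).1 (ha.periodize t).coeFn_toInf)
    -- At the right endpoint the periodic extension has already restarted with `a 0`.
    have h2 : ∀ᵐ τ : ℝ, τ ≠ t := by simp [ae_iff]
    rw [EventuallyEq, ae_restrict_iff' measurableSet_Icc]
    filter_upwards [h1, h2, (ae_restrict_iff' measurableSet_Icc).1 hAa] with τ h1 h2 h3 hτ
    rw [h1 (Set.mem_Ici.2 (add_nonneg (by positivity) hτ.1)), h3 hτ]
    exact periodize_apply ⟨hτ.1, lt_of_le_of_ne hτ.2 h2⟩ k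

theorem flow_periodize {t : ℝ} {a : ℝ → Mat E} : flow (periodize t a) t = flow a t := by
  refine flow_congr ?_
  have h2 : ∀ᵐ τ : ℝ, τ ≠ t := by simp [ae_iff]
  rw [EventuallyEq, ae_restrict_iff' measurableSet_Icc]
  filter_upwards [h2] with τ h2 hτ
  simpa using periodize_apply (a := a) ⟨hτ.1, lt_of_le_of_ne hτ.2 h2⟩ 0

/-- `F` consists of signals bounded by `M`. -/
def FinBounded (M : ℝ) (F : (t : ℝ≥0) → Set (FinSignal E t)) : Prop :=
  0 ≤ M ∧ ∀ t : ℝ≥0, ∀ A ∈ F t, ∀ᵐ τ ∂(volume.restrict (Set.Icc (0 : ℝ) (t : ℝ))), ‖A τ‖ ≤ M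

/-- `S` consists of signals bounded by `M`. -/
def InfBounded (M : ℝ) (S : Set (InfSignal E)) : Prop :=
  0 ≤ M ∧ ∀ A ∈ S, ∀ᵐ τ ∂(volume.restrict (Set.Ici (0 : ℝ))), ‖A τ‖ ≤ M

theorem FinBounded.exists_isBddSignal (hF : FinBounded M F) {t : ℝ≥0} {A : FinSignal E t}
    (hA : A ∈ F t) : ∃ a, IsBddSignal M a ∧ A =ᵐ[volume.restrict (Set.Icc 0 (t : ℝ))] a :=
  exists_isBddSignal_ae_eq hF.1 (Lp.aestronglyMeasurable A) (hF.2 t A hA)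

theorem InfBounded.exists_isBddSignal (hS : InfBounded M S) {A : InfSignal E} (hA : A ∈ S) :
    ∃ a, IsBddSignal M a ∧ A =ᵐ[volume.restrict (Set.Ici 0)] a :=
  exists_isBddSignal_ae_eq hS.1 (Lp.aestronglyMeasurable A) (hS.2 A hA)

theorem FinBounded.exists_flow_eq (hF : FinBounded M F) {t : ℝ≥0} {R : Mat E}
    (hR : R ∈ PhiAt F t) : ∃ A ∈ F t, ∃ a, IsBddSignal M a ∧
      A =ᵐ[volume.restrict (Set.Icc 0 (t : ℝ))] a ∧ flow a t = R := by
  obtain ⟨A, hA, rfl⟩ := hR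
  obtain ⟨a, ha, hAa⟩ := hF.exists_isBddSignal hA
  exact ⟨A, hA, a, ha, hAa, (flow_congr hAa).symm⟩

/-- Every element of `Φ(F_t)` is the flow of a periodic signal in `F_∞`. -/
theorem FinBounded.exists_mem_Finfty (hF : FinBounded M F) {t : ℝ≥0} (ht : 0 < t) {R : Mat E}
    (hR : R ∈ PhiAt F t) : ∃ P ∈ Finfty F, ∃ p, IsBddSignal M p ∧
      P =ᵐ[volume.restrict (Set.Ici 0)] p ∧ flow P t = R := by
  obtain ⟨A, hA, a, ha, hAa, rfl⟩ := hF.exists_flow_eq hR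
  exact ⟨_, toInf_periodize_mem_Finfty ht hA ha hAa, _, ha.periodize t,
    (ha.periodize t).coeFn_toInf,
    (flow_congr_Ici (ha.periodize t).coeFn_toInf t).trans flow_periodize⟩

theorem Fat.exists_nonempty (hS : S.Nonempty) (h : Fat S F) (t : ℝ≥0) :
    ∃ t', t ≤ t' ∧ (PhiAt F t').Nonempty := by
  obtain ⟨A, hA⟩ := hS
  obtain ⟨-, C, Δ, 𝓚, -, -, h1, -⟩ := h
  obtain ⟨K, -, t', ht', R, hR, -⟩ := h1 t A hA
  exact ⟨t', ht'.1, R, hR⟩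

/-! ### Consequences of shift invariance and fatness -/

section Complete

variable [CompleteSpace E]

theorem FinBounded.mul_mem (hF : FinBounded M F) (hA1 : Concatenable F) (s t : ℝ≥0) :
    ∀ R ∈ PhiAt F s, ∀ T ∈ PhiAt F t, T * R ∈ PhiAt F (s + t) := by
  intro R hR T hT
  obtain ⟨A, hA, a, ha, hAa, rfl⟩ := hF.exists_flow_eq hR
  obtain ⟨B, hB, b, hb, hBb, rfl⟩ := hF.exists_flow_eq hT
  obtain ⟨D, hD, hDAB⟩ := hA1 s t A hA B hB
  refine ⟨D, hD, ?_⟩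
  have hab := concat_ae_eq hAa hBb
  rw [← NNReal.coe_add] at hab
  rw [← ha.flow_concat hb s.coe_nonneg t.coe_nonneg, ← NNReal.coe_add]
  exact flow_congr (hDAB.trans hab)

theorem FinBounded.norm_le (hF : FinBounded M F) (t : ℝ≥0) :
    ∀ R ∈ PhiAt F t, ‖R‖ ≤ Real.exp (M * t) := by
  intro R hR
  obtain ⟨A, hA, a, ha, hAa, rfl⟩ := hF.exists_flow_eq hR
  exact ha.norm_flow_le t.coe_nonneg

theorem FinBounded.isUnit [FiniteDimensional ℝ E] (hF : FinBounded M F) {t : ℝ≥0} {R : Mat E}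
    (hR : R ∈ PhiAt F t) : IsUnit R := by
  obtain ⟨A, hA, a, ha, hAa, rfl⟩ := hF.exists_flow_eq hR
  exact ha.isUnit_flow t.coe_nonneg

theorem FinBounded.exp_neg_rpow_le_norm [Nontrivial E] (hF : FinBounded M F) {t : ℝ≥0}
    {R : Mat E} (hR : R ∈ PhiAt F t) : Real.exp (-M) ^ (t : ℝ) ≤ ‖R‖ := by
  obtain ⟨A, hA, a, ha, hAa, rfl⟩ := hF.exists_flow_eq hR
  obtain ⟨x, hx⟩ := exists_ne (0 : E)
  have hn : 0 < ‖x‖ := norm_pos_iff.2 hx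
  have h1 : ‖x‖ ≤ Real.exp (M * t) * (‖flow a t‖ * ‖x‖) :=
    (ha.norm_le_exp_mul_norm_flow_apply t.coe_nonneg x).trans
      (mul_le_mul_of_nonneg_left ((flow a t).le_opNorm x) (Real.exp_nonneg _))
  have h2 : 1 ≤ Real.exp (M * t) * ‖flow a t‖ := by
    refine le_of_mul_le_mul_right ?_ hn
    rw [one_mul, mul_assoc]
    exact h1
  rw [← Real.exp_mul, neg_mul, Real.exp_neg]
  exact (inv_le_iff_one_le_mul₀' (Real.exp_pos _)).2 h2

/-- The flow of a signal in `S` factors through the flow of a shifted signal, again in `S`. -/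
theorem InfBounded.exists_flow_add (hS : InfBounded M S) (hA0 : ShiftInvariant S)
    {A : InfSignal E} (hA : A ∈ S) (s t : ℝ≥0) :
    ∃ B ∈ S, flow A ((s : ℝ) + t) = flow B t * flow A s := by
  obtain ⟨a, ha, hAa⟩ := hS.exists_isBddSignal hA
  obtain ⟨B, hB, hBA⟩ := hA0 A hA s
  refine ⟨B, hB, ?_⟩
  have h1 : ∀ᵐ τ : ℝ, (s : ℝ) + τ ∈ Set.Ici (0 : ℝ) → A ((s : ℝ) + τ) = a ((s : ℝ) + τ) :=
    (measurePreserving_add_left volume (s : ℝ)).quasiMeasurePreserving.ae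
      ((ae_restrict_iff' measurableSet_Ici).1 hAa)
  have h2 : B =ᵐ[volume.restrict (Set.Ici (0 : ℝ))] fun τ => a ((s : ℝ) + τ) := by
    refine hBA.trans ?_
    rw [EventuallyEq, ae_restrict_iff' measurableSet_Ici]
    filter_upwards [h1] with τ h1 hτ
    exact h1 (Set.mem_Ici.2 (add_nonneg s.coe_nonneg hτ))
  rw [flow_congr_Ici hAa, flow_congr_Ici hAa, flow_congr_Ici h2,
    ha.flow_add s.coe_nonneg t.coe_nonneg]

theorem InfBounded.norm_flow_le (hS : InfBounded M S) {A : InfSignal E} (hA : A ∈ S) (t : ℝ≥0) :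
    ‖flow A t‖ ≤ Real.exp (M * t) := by
  obtain ⟨a, ha, hAa⟩ := hS.exists_isBddSignal hA
  rw [flow_congr_Ici hAa]
  exact ha.norm_flow_le t.coe_nonneg

/-- Fatness: up to a constant, flows of `S` are dominated by elements of `Φ(F)` of comparable
length. -/
theorem Fat.exists_norm_flow_le [FiniteDimensional ℝ E] (hF : FinBounded M F) (h : Fat S F) :
    ∃ (D : ℝ) (Δ : ℝ≥0), 0 < D ∧ ∀ t : ℝ≥0, ∀ A ∈ S, ∃ t' ∈ Set.Icc t (t + Δ),
      ∃ R ∈ PhiAt F t', ‖flow A t‖ ≤ D * ‖R‖ := by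
  obtain ⟨-, C, Δ, 𝓚, hC, h𝓚, h1, -⟩ := h
  -- Inversion is continuous on the group of units, so compactness of `𝓚` also bounds the inverses.
  obtain ⟨B, hB⟩ := h𝓚.exists_bound_of_continuousOn (f := fun K => ((K⁻¹ : (Mat E)ˣ) : Mat E))
    (Units.continuous_val.comp continuous_inv).continuousOn
  refine ⟨C * max B 0 + 1, Δ, by positivity, fun t A hA => ?_⟩
  obtain ⟨K, hK, t', ht', R, hR, hle⟩ := h1 t A hA
  refine ⟨t', ht', R, hR, ?_⟩
  have heq : flow A t =
      flow A t * (K : Mat E) * Ring.inverse R * R * ((K⁻¹ : (Mat E)ˣ) : Mat E) := by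
    rw [Ring.inverse_mul_cancel_right _ _ (hF.isUnit hR), Units.mul_inv_cancel_right]
  rw [heq]
  calc _ ≤ ‖flow A t * (K : Mat E) * Ring.inverse R‖ * ‖R‖ * ‖((K⁻¹ : (Mat E)ˣ) : Mat E)‖ :=
        (norm_mul_le _ _).trans
          (mul_le_mul_of_nonneg_right (norm_mul_le _ _) (norm_nonneg _))
    _ ≤ C * ‖R‖ * max B 0 := by
        gcongr
        exact (hB K hK).trans (le_max_left _ _)
    _ ≤ _ := by nlinarith [norm_nonneg R]

/-- Reversed Grönwall gives norm at least `exp (-M t)`, and fatness provides products of arbitrarily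
large length. -/
theorem mu_pos [Nontrivial E] (hF : FinBounded M F) (hS : S.Nonempty) (h : Fat S F) :
    0 < mu F := by
  refine (Real.exp_pos (-M)).trans_le (le_mu_of_frequently hF.norm_le (Real.exp_nonneg _) ?_)
  intro t₀
  obtain ⟨t, ht, R, hR⟩ := h.exists_nonempty hS t₀
  exact ⟨t, ht, R, hR, hF.exp_neg_rpow_le_norm hR⟩

theorem rpow_le_max_rpow_mul {μ : ℝ} (hμ : 0 < μ) {t t' Δ : ℝ≥0} (ht' : t' ∈ Set.Icc t (t + Δ)) :
    μ ^ (t' : ℝ) ≤ max 1 μ ^ (Δ : ℝ) * μ ^ (t : ℝ) := by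
  have h1 : (t : ℝ) ≤ t' := ht'.1
  have h2 : (t' : ℝ) ≤ t + Δ := by exact_mod_cast ht'.2
  have h3 : (t' : ℝ) = (t' - t) + t := by ring
  rw [h3, Real.rpow_add hμ]
  refine mul_le_mul_of_nonneg_right ?_ (by positivity)
  exact (Real.rpow_le_rpow hμ.le (le_max_right 1 μ) (by linarith)).trans
    (Real.rpow_le_rpow_of_exponent_le (le_max_left _ _) (by linarith))

/-- If the flows of `S` at time `T` have norm at most `c ^ T`, then flows of `S` grow at most
like `c ^ t`. -/
theorem InfBounded.exists_norm_flow_le_rpow (hS : InfBounded M S) (hA0 : ShiftInvariant S)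
    {c : ℝ} (hc : 0 < c) {T : ℝ≥0} (hT : 0 < T) (h : ∀ A ∈ S, ‖flow A T‖ ≤ c ^ (T : ℝ)) :
    ∃ D, 0 < D ∧ ∀ t : ℝ≥0, ∀ A ∈ S, ‖flow A t‖ ≤ D * c ^ (t : ℝ) := by
  have hM := hS.1
  -- The constant pays for the one piece of length at most `T` left after removing blocks of length
  -- `T`; the `max` covers the case `c < 1`.
  refine ⟨Real.exp (M * T) * max 1 c⁻¹ ^ (T : ℝ), by positivity, fun t => ?_⟩
  set D := Real.exp (M * T) * max 1 c⁻¹ ^ (T : ℝ) with hD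
  obtain ⟨N, hN⟩ := Archimedean.arch t hT
  induction N generalizing t with
  | zero =>
    intro A hA
    refine (hS.norm_flow_le hA t).trans ?_
    have ht : t = 0 := by simpa using hN
    subst ht
    have h1 : 1 ≤ Real.exp (M * T) := Real.one_le_exp (by positivity)
    have h2 : 1 ≤ max 1 c⁻¹ ^ (T : ℝ) := Real.one_le_rpow (le_max_left _ _) T.coe_nonneg
    simpa using one_le_mul_of_one_le_of_one_le h1 h2
  | succ N ih =>
    intro A hA
    rcases le_total t T with ht | ht
    · refine (hS.norm_flow_le hA t).trans ?_
      have ht' : (t : ℝ) ≤ T := ht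
      have h1 : Real.exp (M * t) ≤ Real.exp (M * T) := by gcongr
      have h2 : 1 ≤ max 1 c⁻¹ ^ (T : ℝ) * c ^ (t : ℝ) := by
        have h3 : (c⁻¹) ^ (t : ℝ) ≤ max 1 c⁻¹ ^ (T : ℝ) :=
          (Real.rpow_le_rpow (by positivity) (le_max_right 1 c⁻¹) t.coe_nonneg).trans
            (Real.rpow_le_rpow_of_exponent_le (le_max_left _ _) ht')
        rw [Real.inv_rpow hc.le] at h3
        rwa [← inv_le_iff_one_le_mul₀ (by positivity)]
      rw [hD, mul_assoc]
      exact h1.trans (le_mul_of_one_le_right (by positivity) h2)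
    · obtain ⟨u, rfl⟩ := exists_add_of_le ht
      obtain ⟨B, hB, hBA⟩ := hS.exists_flow_add hA0 hA T u
      have hu : u ≤ N • T := by
        rw [succ_nsmul, add_comm] at hN
        exact le_of_add_le_add_right hN
      rw [NNReal.coe_add, hBA, Real.rpow_add hc]
      calc _ ≤ ‖flow B u‖ * ‖flow A T‖ := norm_mul_le _ _
        _ ≤ (D * c ^ (u : ℝ)) * c ^ (T : ℝ) :=
            mul_le_mul (ih u hu B hB) (h A hA) (norm_nonneg _) (by positivity)
        _ = _ := by ring

theorem Fat.not_small [FiniteDimensional ℝ E] [Nontrivial E] (hF : FinBounded M F)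
    (hS : InfBounded M S) (hne : S.Nonempty) (hA0 : ShiftInvariant S) (h : Fat S F) :
    ∃ ε : ℝ, 0 < ε ∧ ∀ t₀ : ℝ≥0, ∃ t, t₀ ≤ t ∧ ∃ R ∈ PhiAt F t, ε * mu F ^ (t : ℝ) ≤ ‖R‖ := by
  have hμ := mu_pos hF hne h
  obtain ⟨D, Δ, hD, hDR⟩ := h.exists_norm_flow_le hF
  have hL : 0 < max 1 (mu F) ^ (Δ : ℝ) := by positivity
  set L := max 1 (mu F) ^ (Δ : ℝ)
  by_contra hcon
  push Not at hcon
  -- The loss `D` in fatness and the loss `L` from the delay up to `Δ` leave exactly the factor `1 /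
  -- 2`.
  obtain ⟨t₀, ht₀⟩ := hcon (1 / (2 * D * L)) (by positivity)
  set T := t₀ + 1
  have hT : 0 < T := by positivity
  have hT' : (0 : ℝ) < T := hT
  -- The rate with `c ^ T = μ^T / 2`, strictly below `mu F`.
  set c := (1 / 2 : ℝ) ^ (1 / (T : ℝ)) * mu F with hc
  have hc0 : 0 < c := by positivity
  have hcT : c ^ (T : ℝ) = 1 / 2 * mu F ^ (T : ℝ) := by
    rw [hc, Real.mul_rpow (by positivity) hμ.le, ← Real.rpow_mul (by norm_num),
      one_div_mul_cancel hT'.ne', Real.rpow_one]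
  obtain ⟨B, hB, hBt⟩ := hS.exists_norm_flow_le_rpow hA0 hc0 hT fun A hA => by
    obtain ⟨t', ht', R, hR, hle⟩ := hDR T A hA
    have h1 := (ht₀ t' (le_self_add.trans ht'.1) R hR).le
    have h2 := rpow_le_max_rpow_mul hμ ht'
    calc ‖flow A T‖ ≤ D * ‖R‖ := hle
      _ ≤ D * (1 / (2 * D * L) * (L * mu F ^ (T : ℝ))) := by gcongr; exact h1.trans (by gcongr)
      _ = c ^ (T : ℝ) := by rw [hcT]; field_simp
  have hle : mu F ≤ c := mu_le_of_norm_le hc0 hB fun t ht R hR => by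
    obtain ⟨P, hP, -, -, -, rfl⟩ := hF.exists_mem_Finfty ht hR
    exact hBt t P (h.1 hP)
  have hlt : (1 / 2 : ℝ) ^ (1 / (T : ℝ)) < 1 :=
    Real.rpow_lt_one (by norm_num) (by norm_num) (by positivity)
  nlinarith

end Complete

theorem isRegularSemigroup [FiniteDimensional ℝ E] [Nontrivial E] (hF : FinBounded M F)
    (hS : InfBounded M S) (hne : S.Nonempty) (hA0 : ShiftInvariant S) (hA1 : Concatenable F)
    (hA2 : IsIrreducible (Phi F)) (h : Fat S F) : IsRegularSemigroup F := by
  have : CompleteSpace E := FiniteDimensional.complete ℝ E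
  have hμ := mu_pos hF hne h
  exact ⟨hF.mul_mem hA1, hμ, hA2,
    quasiExtremal_of_irreducible (hF.mul_mem hA1) hF.norm_le hμ hA2,
    h.not_small hF hS hne hA0⟩

end

/-! ### Quasi-extremal trajectories -/

section

variable {E : Type*} [NormedAddCommGroup E] [NormedSpace ℝ E]
  {F : (t : ℝ≥0) → Set (FinSignal E t)} {S : Set (InfSignal E)} {M : ℝ}

theorem mem_weakStarClosure_of_tendsto [CompleteSpace E] (l : Ultrafilter ℕ)
    {X : Set (InfSignal E)} {P : ℕ → InfSignal E} (hP : ∀ k, P k ∈ X) {p : ℕ → ℝ → Mat E}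
    (hp : ∀ k, IsBddSignal M (p k)) (hPp : ∀ k, P k =ᵐ[volume.restrict (Set.Ici 0)] p k)
    {a : ℝ → Mat E} (ha : IsBddSignal M a)
    (h : ∀ s t, Tendsto (fun k => ∫ r in s..t, p k r) l (𝓝 (∫ r in s..t, a r))) :
    ha.toInf ∈ weakStarClosure X := by
  let _ : TopologicalSpace (InfSignal E) := weakStarTopology E
  refine mem_closure_of_tendsto (b := (l : Filter ℕ)) (f := P) ?_ (.of_forall hP)
  rw [nhds_induced, tendsto_comap_iff, tendsto_pi_nhds]
  intro φ
  have hlim := tendsto_setIntegral_clm_apply ha.nonneg (fun k => (hp k).meas)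
    (fun k => (hp k).norm_le) ha.meas ha.norm_le h measurableSet_Ici (L1.integrable_coeFn φ)
  have key : ∀ {A : InfSignal E} {b : ℝ → Mat E}, A =ᵐ[volume.restrict (Set.Ici 0)] b →
      ∫ τ in Set.Ici (0 : ℝ), (φ τ) (A τ) = ∫ τ in Set.Ici (0 : ℝ), (φ τ) (b τ) :=
    fun hAb => integral_congr_ae (hAb.mono fun τ hτ => by beta_reduce; rw [hτ])
  simp only [Function.comp_apply]
  rw [key ha.coeFn_toInf]
  simp_rw [key (hPp _)]
  exact hlim

variable [FiniteDimensional ℝ E]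

/-- Fatness carries quasi-extremality from `Φ(F)` to all of `S`, where shifted signals also live. -/
theorem exists_norm_flow_le_mu (hF : FinBounded M F) (h : Fat S F) (hR : IsRegularSemigroup F) :
    ∃ B, 0 < B ∧ ∀ t : ℝ≥0, ∀ A ∈ S, ‖flow A t‖ ≤ B * mu F ^ (t : ℝ) := by
  have : CompleteSpace E := FiniteDimensional.complete ℝ E
  have hμ := hR.mu_pos
  obtain ⟨D, Δ, hD, hDR⟩ := h.exists_norm_flow_le hF
  obtain ⟨C, hC, hCR⟩ := hR.quasiExtremal
  refine ⟨D * (C * max 1 (mu F) ^ (Δ : ℝ)), by positivity, fun t A hA => ?_⟩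
  obtain ⟨t', ht', R, hR, hle⟩ := hDR t A hA
  calc ‖flow A t‖ ≤ D * ‖R‖ := hle
    _ ≤ D * (C * (max 1 (mu F) ^ (Δ : ℝ) * mu F ^ (t : ℝ))) := by
        gcongr
        exact (hCR t' R hR).trans
          (mul_le_mul_of_nonneg_left (rpow_le_max_rpow_mul hμ ht') hC.le)
    _ = _ := by ring

/-- Signals in `F_∞` along which a given vector grows like `μ^t` up to an arbitrarily large
time. -/
theorem exists_mem_Finfty_le_norm_flow (hF : FinBounded M F) (hS : InfBounded M S)
    (hA0 : ShiftInvariant S) (hFS : Finfty F ⊆ S) (hμ : 0 < mu F) {B c : ℝ} (hB : 0 < B)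
    (hBS : ∀ t : ℝ≥0, ∀ A ∈ S, ‖flow A t‖ ≤ B * mu F ^ (t : ℝ))
    {x : E} (hc : ∀ t : ℝ≥0, ∃ t' : ℝ≥0, t ≤ t' ∧
      ∃ R ∈ PhiAt F t', c * mu F ^ (t' : ℝ) * ‖x‖ ≤ ‖R x‖) (k : ℕ) :
    ∃ P ∈ Finfty F, ∃ p, IsBddSignal M p ∧ P =ᵐ[volume.restrict (Set.Ici 0)] p ∧
      ∀ t : ℝ≥0, t ≤ k → c / B * mu F ^ (t : ℝ) * ‖x‖ ≤ ‖flow P t x‖ := by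
  have : CompleteSpace E := FiniteDimensional.complete ℝ E
  obtain ⟨T, hT, R, hR, hRx⟩ := hc (k + 1)
  have hT0 : 0 < T := lt_of_lt_of_le (by positivity) hT
  obtain ⟨P, hP, p, hp, hPp, rfl⟩ := hF.exists_mem_Finfty hT0 hR
  refine ⟨P, hP, p, hp, hPp, fun t ht => ?_⟩
  obtain ⟨u, rfl⟩ := exists_add_of_le (ht.trans (le_self_add.trans hT))
  -- Cut the signal at `t`: the remaining piece, of length `u`, expands by at most `B μ^u`, so `x`
  -- must already have size at least `c / B * μ^t * ‖x‖`.
  obtain ⟨A, hA, hAP⟩ := hS.exists_flow_add hA0 (hFS hP) t u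
  rw [NNReal.coe_add, hAP, Real.rpow_add hμ] at hRx
  have h1 : ‖(flow A u * flow P t) x‖ ≤ B * mu F ^ (u : ℝ) * ‖flow P t x‖ :=
    (flow A u).le_of_opNorm_le (hBS u A hA) _
  have h2 : 0 < B * mu F ^ (u : ℝ) := by positivity
  refine le_of_mul_le_mul_left ?_ h2
  calc B * mu F ^ (u : ℝ) * (c / B * mu F ^ (t : ℝ) * ‖x‖)
      = c * (mu F ^ (t : ℝ) * mu F ^ (u : ℝ)) * ‖x‖ := by field_simp
    _ ≤ _ := hRx.trans h1

theorem exists_isQuasiExtremalTrajectory (hF : FinBounded M F) (hS : InfBounded M S)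
    (hA0 : ShiftInvariant S) (h : Fat S F) (hR : IsRegularSemigroup F) :
    ∃ C : ℝ, 1 ≤ C ∧ ∀ x₀ : E, x₀ ≠ 0 → ∃ A : InfSignal E,
      IsQuasiExtremalTrajectory F C A x₀ := by
  have : CompleteSpace E := FiniteDimensional.complete ℝ E
  have hμ := hR.mu_pos
  obtain ⟨B, hB, hBS⟩ := exists_norm_flow_le_mu hF h hR
  obtain ⟨-, c, hc, hcR⟩ := hR.quasiBarabanov
  refine ⟨max 1 (max B (B / c)), le_max_left _ _, fun x₀ hx₀ => ?_⟩
  set C := max 1 (max B (B / c)) with hC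
  have hC0 : 0 < C := lt_max_of_lt_left one_pos
  choose P hP p hp hPp hlow using
    exists_mem_Finfty_le_norm_flow hF hS hA0 h.1 hμ hB hBS (hcR x₀)
  -- A nonprincipal ultrafilter yields all limits at once and lies beyond every fixed `t`, so the
  -- lower bounds, valid only up to time `k`, survive for all times.
  let l : Ultrafilter ℕ := hyperfilter ℕ
  obtain ⟨a, ham, hab, hlim⟩ := exists_tendsto_intervalIntegral l hF.1
    (fun k => (hp k).meas) (fun k => (hp k).norm_le)
  have ha : IsBddSignal M a := ⟨ham, hab⟩
  refine ⟨ha.toInf, hx₀, mem_weakStarClosure_of_tendsto l hP hp hPp ha hlim, fun t => ?_⟩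
  rw [flow_congr_Ici ha.coeFn_toInf]
  have hflow : Tendsto (fun k => flow (p k) t) l (𝓝 (flow a t)) :=
    tendsto_flow l hp ha hlim t.coe_nonneg
  have hnorm : Tendsto (fun k => ‖flow (p k) t x₀‖) l (𝓝 ‖flow a t x₀‖) :=
    (((ContinuousLinearMap.apply ℝ E x₀).continuous.tendsto _).comp hflow).norm
  constructor
  · have hle : 1 / C ≤ c / B := by
      rw [div_le_div_iff₀ hC0 hB, one_mul, ← div_le_iff₀' hc]
      exact (le_max_right _ _).trans (le_max_right _ _)
    have hev : ∀ᶠ k : ℕ in l, t ≤ (k : ℝ≥0) :=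
      Nat.hyperfilter_le_atTop (tendsto_natCast_atTop_atTop.eventually_ge_atTop t)
    refine ge_of_tendsto hnorm ?_
    filter_upwards [hev] with k hk
    rw [← flow_congr_Ici (hPp k)]
    refine le_trans ?_ (hlow k t hk)
    gcongr
  · refine le_of_tendsto hnorm (.of_forall fun k => ?_)
    rw [← flow_congr_Ici (hPp k)]
    refine (flow (P k) t).le_of_opNorm_le ((hBS t _ (h.1 (hP k))).trans ?_) x₀
    have : B ≤ C := (le_max_left _ _).trans (le_max_right _ _)
    gcongr

end

end SwitchedSystem


/-! ### The main theorem -/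

theorem mainTheorem4 {E : Type*} [NormedAddCommGroup E] [NormedSpace ℝ E]
    [FiniteDimensional ℝ E] [Nontrivial E]
    (𝓜 : Set (SwitchedSystem.Mat E)) (h𝓜 : Bornology.IsBounded 𝓜)
    (S : Set (SwitchedSystem.InfSignal E)) (hS : S.Nonempty)
    (hS𝓜 : ∀ A ∈ S, ∀ᵐ τ ∂(volume.restrict (Set.Ici (0 : ℝ))), A τ ∈ 𝓜)
    (F : (t : ℝ≥0) → Set (SwitchedSystem.FinSignal E t))
    (hF𝓜 : ∀ t : ℝ≥0, ∀ A ∈ F t,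
      ∀ᵐ τ ∂(volume.restrict (Set.Icc (0 : ℝ) (t : ℝ))), A τ ∈ 𝓜)
    (hA0 : SwitchedSystem.ShiftInvariant S)
    (hA1 : SwitchedSystem.Concatenable F)
    (hA2 : SwitchedSystem.IsIrreducible (SwitchedSystem.Phi F))
    (hA3 : SwitchedSystem.Fat S F) :
    -- structure of the limit set
    (IsCompact (SwitchedSystem.Rinfty F) ∧ (SwitchedSystem.Rinfty F).Nonempty ∧
      SwitchedSystem.Rinfty F ≠ {0}) ∧
    (∀ P ∈ SwitchedSystem.Rinfty F, ∀ Q ∈ SwitchedSystem.Rinfty F,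
      P * Q ∈ SwitchedSystem.Rinfty F) ∧
    (∀ t : ℝ≥0, ∀ T ∈ SwitchedSystem.PhiAt F t, ∀ Q ∈ SwitchedSystem.Rinfty F,
      SwitchedSystem.mu F ^ (-(t : ℝ)) • (T * Q) ∈ SwitchedSystem.Rinfty F ∧
      SwitchedSystem.mu F ^ (-(t : ℝ)) • (Q * T) ∈ SwitchedSystem.Rinfty F) ∧
    SwitchedSystem.IsIrreducible (SwitchedSystem.Rinfty F) ∧
    -- the maximum defining `v̂` is attained, and `v̂` is an extremal norm
    (∀ x : E, IsGreatest ((fun R : SwitchedSystem.Mat E => ‖R x‖) '' SwitchedSystem.Rinfty F)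
      (SwitchedSystem.vhat F x)) ∧
    SwitchedSystem.IsExtremalNorm F (SwitchedSystem.vhat F) ∧
    -- the semigroup is extremal and quasi-Barabanov
    SwitchedSystem.Extremal F ∧
    SwitchedSystem.QuasiBarabanov F ∧
    -- quasi-extremal trajectories, with a uniform constant, start at every nonzero point
    (∃ C : ℝ, 1 ≤ C ∧ ∀ x₀ : E, x₀ ≠ 0 → ∃ A : SwitchedSystem.InfSignal E,
      SwitchedSystem.IsQuasiExtremalTrajectory F C A x₀) := by
  obtain ⟨M, hM⟩ := isBounded_iff_forall_norm_le.1 h𝓜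
  have hle : ∀ A ∈ 𝓜, ‖A‖ ≤ max M 0 := fun A hA => (hM A hA).trans (le_max_left _ _)
  have hF : SwitchedSystem.FinBounded (max M 0) F :=
    ⟨le_max_right _ _, fun t A hA => (hF𝓜 t A hA).mono fun τ hτ => hle _ hτ⟩
  have hSb : SwitchedSystem.InfBounded (max M 0) S :=
    ⟨le_max_right _ _, fun A hA => (hS𝓜 A hA).mono fun τ hτ => hle _ hτ⟩
  have hR := SwitchedSystem.isRegularSemigroup hF hSb hS hA0 hA1 hA2 hA3
  exact ⟨⟨hR.isCompact_Rinfty, hR.nonempty_Rinfty, hR.Rinfty_ne_singleton_zero⟩,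
    fun P hP Q hQ => hR.mul_mem_Rinfty hP hQ,
    fun t T hT Q hQ => ⟨hR.smul_mul_mem_Rinfty hT hQ, hR.smul_mul_mem_Rinfty' hT hQ⟩,
    hR.isIrreducible_Rinfty, hR.isGreatest_vhat, hR.isExtremalNorm_vhat, hR.extremal,
    hR.quasiBarabanov, SwitchedSystem.exists_isQuasiExtremalTrajectory hF hSb hA0 hA3 hR⟩
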